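/- **Proposition 4.1.** Let $d\ge 2$ and $n\ge 1$ be integers. Let $\mathrm{Rat}_d\subset\mathbb P^{2d+1}(\mathbb C)$ be the space of rational functions $$f(z)=\frac{a_dz^d+\cdots+a_0}{b_dz^d+\cdots+b_0}$$ of degree exactly $d$, i.e. the open set of points $[a_0:\dots:a_d:b_0:\dots:b_d]$ for which the binary forms $\sum_i a_i x^iy^{d-i}$ and $\sum_i b_i x^iy^{d-i}$ have no common zero in $\mathbb C^2\setminus\{0\}$, with its structure of complex manifold as an open subset of $\mathbb P^{2d+1}(\mathbb C)$. Let $\phi_{d,n}:\mathrm{Rat}_d\to\mathrm{Rat}_{d^n}$ be the iteration map $\phi_{d,n}(f)=f^n=f\circ\cdots\circ f$ ($n$ factors). Then $\phi_{d,n}$ is nonsingular: for every $f\in\mathrm{Rat}_d$ the differential $(\phi_{d,n})_*:T_f\mathrm{Rat}_d\to T_{f^n}\mathrm{Rat}_{d^n}$ is injective. In particular, $\phi_{d,n}$ is a holomorphic immersion from $\mathrm{Rat}_d$ to $\mathrm{Rat}_{d^n}$. -/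

import Mathlib

open scoped LinearAlgebra.Projectivization ContDiff Manifold

noncomputable section

namespace ComplexProj

/-! ### Complex projective space as a complex manifold -/

variable {n : ℕ}

/-- The quotient topology on `ℙⁿ(ℂ) = (ℂⁿ⁺¹ \ {0}) / ℂˣ`. -/
instance instTopologicalSpace : TopologicalSpace (ℙ ℂ (Fin (n + 1) → ℂ)) :=
  inferInstanceAs (TopologicalSpace
    (Quotient (projectivizationSetoid ℂ (Fin (n + 1) → ℂ))))

theorem isQuotientMap_mk' :
    Topology.IsQuotientMap
      (Projectivization.mk' ℂ : {v : Fin (n + 1) → ℂ // v ≠ 0} → ℙ ℂ (Fin (n + 1) → ℂ)) :=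
  isQuotientMap_quot_mk

theorem exists_smul_rep (v : Fin (n + 1) → ℂ) (hv : v ≠ 0) :
    ∃ a : ℂ, a ≠ 0 ∧ (Projectivization.mk ℂ v hv).rep = a • v := by
  obtain ⟨a, ha⟩ := Projectivization.exists_smul_eq_mk_rep ℂ v hv
  exact ⟨a, a.ne_zero, ha.symm⟩

theorem insertNth_one_ne_zero (i : Fin (n + 1)) (w : Fin n → ℂ) :
    (i.insertNth (1 : ℂ) w : Fin (n + 1) → ℂ) ≠ 0 := by
  intro h
  have := congrFun h i
  simp at this

theorem rep_coord_ne_zero_iff (i : Fin (n + 1)) (v : Fin (n + 1) → ℂ) (hv : v ≠ 0) :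
    (Projectivization.mk ℂ v hv).rep i ≠ 0 ↔ v i ≠ 0 := by
  obtain ⟨a, ha, h⟩ := exists_smul_rep v hv
  simp [h, ha]

theorem rep_div_coord (i j : Fin (n + 1)) (v : Fin (n + 1) → ℂ) (hv : v ≠ 0) :
    (Projectivization.mk ℂ v hv).rep j / (Projectivization.mk ℂ v hv).rep i = v j / v i := by
  obtain ⟨a, ha, h⟩ := exists_smul_rep v hv
  simp [h, mul_div_mul_left _ _ ha]

theorem isOpen_coord_ne_zero (i : Fin (n + 1)) :
    IsOpen {p : ℙ ℂ (Fin (n + 1) → ℂ) | p.rep i ≠ 0} := by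
  rw [← isQuotientMap_mk'.isOpen_preimage]
  have : (Projectivization.mk' ℂ ⁻¹' {p : ℙ ℂ (Fin (n + 1) → ℂ) | p.rep i ≠ 0})
      = {v : {v : Fin (n + 1) → ℂ // v ≠ 0} | v.1 i ≠ 0} := by
    ext v
    exact rep_coord_ne_zero_iff i v.1 v.2
  rw [this]
  exact isOpen_ne_fun ((continuous_apply i).comp continuous_subtype_val) continuous_const

/-- The standard affine chart of `ℙⁿ(ℂ)` on `{vᵢ ≠ 0}`: it sends `[v]` to the tuple of the
quotients `vⱼ / vᵢ`, `j ≠ i`. -/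
def chart (i : Fin (n + 1)) : OpenPartialHomeomorph (ℙ ℂ (Fin (n + 1) → ℂ)) (Fin n → ℂ) where
  toFun p := fun j => p.rep (i.succAbove j) / p.rep i
  invFun w := Projectivization.mk ℂ (i.insertNth (1 : ℂ) w) (insertNth_one_ne_zero i w)
  source := {p | p.rep i ≠ 0}
  target := Set.univ
  map_source' _ _ := Set.mem_univ _
  map_target' w _ := by
    have := (rep_coord_ne_zero_iff i _ (insertNth_one_ne_zero i w)).2 (by simp)
    exact this
  left_inv' p hp := by
    conv_rhs => rw [← p.mk_rep]
    rw [Projectivization.mk_eq_mk_iff']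
    refine ⟨(p.rep i)⁻¹, ?_⟩
    ext k
    rcases Fin.eq_self_or_eq_succAbove i k with rfl | ⟨j, rfl⟩
    · simpa using inv_mul_cancel₀ hp
    · simp [div_eq_inv_mul]
  right_inv' w _ := by
    ext j
    rw [rep_div_coord]
    simp
  open_source := isOpen_coord_ne_zero i
  open_target := isOpen_univ
  continuousOn_toFun := by
    have hq := (isQuotientMap_mk' (n := n)).continuousOn_isOpen_iff (isOpen_coord_ne_zero i)
      (g := fun (p : ℙ ℂ (Fin (n + 1) → ℂ)) => fun j : Fin n => p.rep (i.succAbove j) / p.rep i)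
    rw [hq]
    have : ContinuousOn (fun v : {v : Fin (n + 1) → ℂ // v ≠ 0} =>
        fun j => v.1 (i.succAbove j) / v.1 i)
        (Projectivization.mk' ℂ ⁻¹' {p : ℙ ℂ (Fin (n + 1) → ℂ) | p.rep i ≠ 0}) := by
      refine continuousOn_pi.2 fun j => ContinuousOn.div
        ((continuous_apply _).comp continuous_subtype_val).continuousOn
        ((continuous_apply _).comp continuous_subtype_val).continuousOn ?_
      intro v hv
      exact (rep_coord_ne_zero_iff i v.1 v.2).1 hv
    refine this.congr fun v _ => ?_
    ext j
    exact rep_div_coord i _ v.1 v.2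
  continuousOn_invFun := by
    refine Continuous.continuousOn ?_
    have h : Continuous fun w : Fin n → ℂ =>
        (⟨i.insertNth (1 : ℂ) w, insertNth_one_ne_zero i w⟩ :
          {v : Fin (n + 1) → ℂ // v ≠ 0}) :=
      Continuous.subtype_mk (Continuous.finInsertNth (A := fun _ => ℂ) i continuous_const continuous_id) _
    exact isQuotientMap_mk'.continuous.comp h

theorem exists_rep_coord_ne_zero (p : ℙ ℂ (Fin (n + 1) → ℂ)) : ∃ i, p.rep i ≠ 0 :=
  Function.ne_iff.1 p.rep_nonzero

/-- The atlas of `ℙⁿ(ℂ)` formed by the `n + 1` standard affine charts. -/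
instance instChartedSpace : ChartedSpace (Fin n → ℂ) (ℙ ℂ (Fin (n + 1) → ℂ)) where
  atlas := Set.range chart
  chartAt p := chart (exists_rep_coord_ne_zero p).choose
  mem_chart_source p := (exists_rep_coord_ne_zero p).choose_spec
  chart_mem_atlas _ := Set.mem_range_self _

/-- `ℙⁿ(ℂ)` is a complex (analytic) manifold of dimension `n`. -/
instance instIsManifold : IsManifold 𝓘(ℂ, Fin n → ℂ) ω (ℙ ℂ (Fin (n + 1) → ℂ)) := by
  apply isManifold_of_contDiffOn
  rintro _ _ ⟨i, rfl⟩ ⟨k, rfl⟩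
  have hcoord : ∀ l : Fin (n + 1),
      ContDiff ℂ ω (fun w : Fin n → ℂ => (i.insertNth (1 : ℂ) w : Fin (n + 1) → ℂ) l) := by
    intro l
    rcases Fin.eq_self_or_eq_succAbove i l with rfl | ⟨j, rfl⟩
    · simpa using contDiff_const
    · simpa using contDiff_apply ℂ ℂ j
  have hmain : ContDiffOn ℂ ω (fun w : Fin n → ℂ => fun j =>
      (i.insertNth (1 : ℂ) w : Fin (n + 1) → ℂ) (k.succAbove j) /
        (i.insertNth (1 : ℂ) w : Fin (n + 1) → ℂ) k)
      {w | (i.insertNth (1 : ℂ) w : Fin (n + 1) → ℂ) k ≠ 0} := by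
    refine contDiffOn_pi.2 fun j => ContDiffOn.div (hcoord _).contDiffOn (hcoord _).contDiffOn ?_
    exact fun w hw => hw
  refine (hmain.congr fun w _ => ?_).mono ?_
  · ext j
    exact rep_div_coord k (k.succAbove j) _ (insertNth_one_ne_zero i w)
  · rintro w ⟨hw, -⟩
    exact (rep_coord_ne_zero_iff k _ (insertNth_one_ne_zero i w)).1 hw.2

end ComplexProj

namespace RatMap

open MvPolynomial

/-! ### Rational maps of degree `d` -/

/-- The two binary forms of degree `d` with coefficient vector
`v = (a₀, …, a_d, b₀, …, b_d)`: the numerator `∑ aᵢ xⁱ y^(d-i)` and the denominator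
`∑ bᵢ xⁱ y^(d-i)`. -/
def forms (d : ℕ) (v : Fin (2 * d + 1 + 1) → ℂ) : Fin 2 → MvPolynomial (Fin 2) ℂ :=
  ![∑ i : Fin (d + 1), C (v ⟨i, by omega⟩) * (X 0 ^ (i : ℕ) * X 1 ^ (d - i)),
    ∑ i : Fin (d + 1), C (v ⟨d + 1 + i, by omega⟩) * (X 0 ^ (i : ℕ) * X 1 ^ (d - i))]

/-- The exponent of `xⁱ y^(d-i)`. -/
def expo (d i : ℕ) : Fin 2 →₀ ℕ := Finsupp.single 0 i + Finsupp.single 1 (d - i)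

/-- The coefficient vector `(a₀, …, a_d, b₀, …, b_d)` of a pair of binary forms of degree `d`. -/
def coeffs (d : ℕ) (P : Fin 2 → MvPolynomial (Fin 2) ℂ) : Fin (2 * d + 1 + 1) → ℂ :=
  fun k => if (k : ℕ) < d + 1 then coeff (expo d k) (P 0) else coeff (expo d (k - (d + 1))) (P 1)

/-- A pair of forms without common zero on `ℂ² \ {0}`. -/
def NoCommonZero (P : Fin 2 → MvPolynomial (Fin 2) ℂ) : Prop :=
  ∀ z : Fin 2 → ℂ, z ≠ 0 → (fun j => eval z (P j)) ≠ 0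

theorem forms_isHomogeneous (d : ℕ) (v : Fin (2 * d + 1 + 1) → ℂ) (j : Fin 2) :
    (forms d v j).IsHomogeneous d := by
  have key : ∀ (c : Fin (d + 1) → ℂ), (∑ i : Fin (d + 1),
      C (c i) * (X 0 ^ (i : ℕ) * X 1 ^ (d - i)) : MvPolynomial (Fin 2) ℂ).IsHomogeneous d := by
    intro c
    refine IsHomogeneous.sum _ _ _ fun i _ => ?_
    have h := ((isHomogeneous_X_pow (R := ℂ) (0 : Fin 2) i).mul
      (isHomogeneous_X_pow (R := ℂ) (1 : Fin 2) (d - i))).C_mul (c i)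
    rwa [Nat.add_sub_cancel' (by omega)] at h
  fin_cases j
  · exact key _
  · exact key _

theorem forms_smul (d : ℕ) (c : ℂ) (v : Fin (2 * d + 1 + 1) → ℂ) (j : Fin 2) :
    forms d (c • v) j = C c * forms d v j := by
  fin_cases j <;> simp [forms, Finset.mul_sum, mul_assoc]

theorem eq_sum_of_isHomogeneous {d : ℕ} {p : MvPolynomial (Fin 2) ℂ} (hp : p.IsHomogeneous d) :
    p = ∑ i : Fin (d + 1), C (coeff (expo d i) p) * (X 0 ^ (i : ℕ) * X 1 ^ (d - i)) := by
  have hmon : ∀ i : ℕ, ∀ c : ℂ, C c * (X 0 ^ i * X 1 ^ (d - i)) = monomial (expo d i) c := by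
    intro i c
    rw [expo, X_pow_eq_monomial, X_pow_eq_monomial, monomial_mul, C_mul_monomial]
    simp
  simp_rw [hmon]
  ext m
  rw [coeff_sum]
  simp_rw [coeff_monomial]
  by_cases hm : m.degree = d
  · have h01 : m 0 + m 1 = d := by
      rw [← hm, Finsupp.degree_eq_sum, Fin.sum_univ_two]
    have hme : expo d (m 0) = m := by
      ext j
      fin_cases j <;> simp [expo, ← h01]
    rw [Finset.sum_eq_single (⟨m 0, by omega⟩ : Fin (d + 1))]
    · simp [hme]
    · intro b _ hb
      rw [if_neg]
      intro h
      apply hb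
      have := DFunLike.congr_fun h 0
      simp [expo] at this
      exact Fin.ext this
    · simp
  · rw [hp.coeff_eq_zero hm, Finset.sum_eq_zero]
    intro b _
    rw [if_neg]
    rintro rfl
    apply hm
    rw [Finsupp.degree_eq_sum, Fin.sum_univ_two]
    simp [expo]
    omega

theorem forms_coeffs {d : ℕ} {P : Fin 2 → MvPolynomial (Fin 2) ℂ}
    (hP : ∀ j, (P j).IsHomogeneous d) : forms d (coeffs d P) = P := by
  ext1 j
  fin_cases j
  · refine Eq.trans ?_ (eq_sum_of_isHomogeneous (hP 0)).symm
    simp only [forms, coeffs, Fin.zero_eta, Matrix.cons_val_zero]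
    refine Finset.sum_congr rfl fun (i : Fin (d + 1)) _ => ?_
    rw [if_pos i.2]
  · refine Eq.trans ?_ (eq_sum_of_isHomogeneous (hP 1)).symm
    simp only [forms, coeffs, Fin.mk_one, Matrix.cons_val_one, Matrix.cons_val_fin_one]
    refine Finset.sum_congr rfl fun (i : Fin (d + 1)) _ => ?_
    rw [if_neg (by simp only [not_lt]; omega), Nat.add_sub_cancel_left]

theorem coeffs_ne_zero {d : ℕ} {P : Fin 2 → MvPolynomial (Fin 2) ℂ}
    (hP : ∀ j, (P j).IsHomogeneous d) (h0 : NoCommonZero P) : coeffs d P ≠ 0 := by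
  intro h
  have h1 := forms_coeffs hP
  rw [h] at h1
  refine h0 (fun _ => 1) (fun hz => one_ne_zero (α := ℂ) (congrFun hz 0)) ?_
  funext j
  rw [← h1]
  fin_cases j <;> simp [forms]

theorem noCommonZero_forms_smul_iff (d : ℕ) {c : ℂ} (hc : c ≠ 0) (v : Fin (2 * d + 1 + 1) → ℂ) :
    NoCommonZero (forms d (c • v)) ↔ NoCommonZero (forms d v) := by
  have : ∀ z : Fin 2 → ℂ, (fun j => eval z (forms d (c • v) j)) =
      c • (fun j => eval z (forms d v j)) := by
    intro z
    ext j
    simp [forms_smul]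
  simp [NoCommonZero, this, hc]

theorem eval_smul_of_isHomogeneous {d : ℕ} {p : MvPolynomial (Fin 2) ℂ} (hp : p.IsHomogeneous d)
    (c : ℂ) (z : Fin 2 → ℂ) : eval (c • z) p = c ^ d * eval z p := by
  rw [eq_sum_of_isHomogeneous hp]
  simp only [map_sum, map_mul, eval_C, map_pow, eval_X, Pi.smul_apply, smul_eq_mul, mul_pow,
    Finset.mul_sum]
  refine Finset.sum_congr rfl fun i _ => ?_
  have : c ^ d = c ^ (i : ℕ) * c ^ (d - i) := by
    rw [← pow_add, Nat.add_sub_cancel' (by omega)]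
  rw [this]
  ring

theorem continuous_eval_forms (d : ℕ) (j : Fin 2) :
    Continuous fun q : (Fin (2 * d + 1 + 1) → ℂ) × (Fin 2 → ℂ) => eval q.2 (forms d q.1 j) := by
  fin_cases j
  · simp only [forms, Fin.zero_eta, Matrix.cons_val_zero, map_sum, map_mul, eval_C, map_pow, eval_X]
    fun_prop
  · simp only [forms, Fin.mk_one, Matrix.cons_val_one, Matrix.cons_val_fin_one, map_sum, map_mul,
      eval_C, map_pow, eval_X]
    fun_prop

theorem isClosed_exists_zero {E : Type*} [TopologicalSpace E] (G : E × (Fin 2 → ℂ) → Fin 2 → ℂ)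
    (hG : Continuous G) : IsClosed {v : E | ∃ z : Metric.sphere (0 : Fin 2 → ℂ) 1, G (v, z) = 0} := by
  have hclosed : IsClosed {q : E × Metric.sphere (0 : Fin 2 → ℂ) 1 | G (q.1, q.2) = 0} :=
    isClosed_eq (by fun_prop) continuous_const
  have himg := isClosedMap_fst_of_compactSpace _ hclosed
  convert himg using 1
  ext v
  simp

theorem isOpen_noCommonZero (d : ℕ) :
    IsOpen {v : Fin (2 * d + 1 + 1) → ℂ | NoCommonZero (forms d v)} := by
  have himg := isClosed_exists_zero
    (fun q : (Fin (2 * d + 1 + 1) → ℂ) × (Fin 2 → ℂ) => fun j => eval q.2 (forms d q.1 j))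
    (continuous_pi fun j => continuous_eval_forms d j)
  rw [← isOpen_compl_iff] at himg
  convert himg using 1
  ext v
  simp only [Set.mem_ofPred_eq, Set.mem_compl_iff, not_exists]
  constructor
  · intro h z
    refine h z.1 fun h0 => ?_
    have := z.2
    simp [h0] at this
  · intro h z hz h0
    refine h ⟨(‖z‖⁻¹ : ℂ) • z, ?_⟩ (funext fun j => ?_)
    · simp [norm_smul, hz]
    · have := congrFun h0 j
      simp only [Pi.zero_apply] at this ⊢
      rw [eval_smul_of_isHomogeneous (forms_isHomogeneous d v j), this, mul_zero]

/-- `Rat_d`, the space of rational maps of degree `d`: the open set of those points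
`[a₀ : … : a_d : b₀ : … : b_d]` of `ℙ^(2d+1)(ℂ)` for which the binary forms
`∑ aᵢ xⁱ y^(d-i)` and `∑ bᵢ xⁱ y^(d-i)` have no common zero on `ℂ² \ {0}`. -/
def RatSpace (d : ℕ) : TopologicalSpace.Opens (ℙ ℂ (Fin (2 * d + 1 + 1) → ℂ)) where
  carrier := {p | NoCommonZero (forms d p.rep)}
  is_open' := by
    rw [← ComplexProj.isQuotientMap_mk'.isOpen_preimage]
    have : (Projectivization.mk' ℂ ⁻¹'
        {p : ℙ ℂ (Fin (2 * d + 1 + 1) → ℂ) | NoCommonZero (forms d p.rep)})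
        = Subtype.val ⁻¹' {v : Fin (2 * d + 1 + 1) → ℂ | NoCommonZero (forms d v)} := by
      ext v
      obtain ⟨a, ha, h⟩ := ComplexProj.exists_smul_rep v.1 v.2
      simp only [Set.mem_preimage, Set.mem_ofPred_eq, Projectivization.mk'_eq_mk, h]
      exact noCommonZero_forms_smul_iff d ha v.1
    rw [this]
    exact (isOpen_noCommonZero d).preimage continuous_subtype_val

theorem mk_mem_ratSpace_iff {d : ℕ} (v : Fin (2 * d + 1 + 1) → ℂ) (hv : v ≠ 0) :
    Projectivization.mk ℂ v hv ∈ RatSpace d ↔ NoCommonZero (forms d v) := by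
  obtain ⟨a, ha, h⟩ := ComplexProj.exists_smul_rep v hv
  change NoCommonZero (forms d (Projectivization.mk ℂ v hv).rep) ↔ _
  rw [h]
  exact noCommonZero_forms_smul_iff d ha v

/-- The self-map `[z] ↦ [h(z) : k(z)]` of `ℙ¹(ℂ)` given by `f = [h : k] ∈ Rat_d`. -/
def toMap {d : ℕ} (f : RatSpace d) (p : ℙ ℂ (Fin 2 → ℂ)) : ℙ ℂ (Fin 2 → ℂ) :=
  Projectivization.mk ℂ (fun j => eval p.rep (forms d f.1.rep j)) (f.2 p.rep p.rep_nonzero)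

/-! ### Iteration -/

/-- The `n`-fold iterate of a pair of binary forms, under substitution. -/
def iterForms (P : Fin 2 → MvPolynomial (Fin 2) ℂ) : ℕ → Fin 2 → MvPolynomial (Fin 2) ℂ
  | 0 => X
  | n + 1 => fun j => bind₁ P (iterForms P n j)

theorem iterForms_isHomogeneous {d : ℕ} {P : Fin 2 → MvPolynomial (Fin 2) ℂ}
    (hP : ∀ j, (P j).IsHomogeneous d) (n : ℕ) (j : Fin 2) :
    (iterForms P n j).IsHomogeneous (d ^ n) := by
  induction n with
  | zero => simpa [iterForms] using isHomogeneous_X ℂ j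
  | succ n ih =>
    rw [pow_succ']
    exact ih.aeval P hP

theorem eval_iterForms (P : Fin 2 → MvPolynomial (Fin 2) ℂ) (n : ℕ) (z : Fin 2 → ℂ) :
    (fun j => eval z (iterForms P n j)) = (fun w : Fin 2 → ℂ => fun j => eval w (P j))^[n] z := by
  induction n generalizing z with
  | zero => ext j; simp [iterForms]
  | succ n ih =>
    rw [Function.iterate_succ_apply, ← ih]
    ext j
    simp only [iterForms, ← aeval_eq_bind₁]
    simpa [coe_aeval_eq_eval] using aeval_bind₁ z P (iterForms P n j)

theorem NoCommonZero.iterForms {P : Fin 2 → MvPolynomial (Fin 2) ℂ} (hP : NoCommonZero P)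
    (n : ℕ) : NoCommonZero (iterForms P n) := by
  intro z hz
  rw [eval_iterForms]
  induction n generalizing z with
  | zero => simpa using hz
  | succ n ih =>
    rw [Function.iterate_succ_apply]
    exact ih _ (hP z hz)

/-- The iteration map `φ_{d,n} : Rat_d → Rat_{dⁿ}`, `f ↦ fⁿ = f ∘ ⋯ ∘ f`. -/
def iterationMap (d n : ℕ) (f : RatSpace d) : RatSpace (d ^ n) :=
  ⟨Projectivization.mk ℂ (coeffs (d ^ n) (iterForms (forms d f.1.rep) n))
      (coeffs_ne_zero (iterForms_isHomogeneous (forms_isHomogeneous d _) n)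
        (NoCommonZero.iterForms f.2 n)),
    (mk_mem_ratSpace_iff _ _).2 (by
      rw [forms_coeffs (iterForms_isHomogeneous (forms_isHomogeneous d _) n)]
      exact NoCommonZero.iterForms f.2 n)⟩

/-- `toMap` may be computed with any representatives. -/
theorem toMap_mk {d : ℕ} (v : Fin (2 * d + 1 + 1) → ℂ) (hv : v ≠ 0)
    (h : Projectivization.mk ℂ v hv ∈ RatSpace d) (z : Fin 2 → ℂ) (hz : z ≠ 0) :
    toMap ⟨Projectivization.mk ℂ v hv, h⟩ (Projectivization.mk ℂ z hz) =
      Projectivization.mk ℂ (fun j => eval z (forms d v j))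
        ((mk_mem_ratSpace_iff v hv).1 h z hz) := by
  obtain ⟨a, ha, hav⟩ := ComplexProj.exists_smul_rep v hv
  obtain ⟨b, hb, hbz⟩ := ComplexProj.exists_smul_rep z hz
  rw [toMap, Projectivization.mk_eq_mk_iff']
  refine ⟨a * b ^ d, ?_⟩
  ext j
  simp only [hav, hbz, forms_smul, map_mul, eval_C, Pi.smul_apply, smul_eq_mul,
    eval_smul_of_isHomogeneous (forms_isHomogeneous d v j)]
  ring

/-- `iterationMap d n f` is the rational map whose self-map of `ℙ¹(ℂ)` is the `n`-th iterate of
that of `f`. -/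
theorem toMap_iterationMap (d n : ℕ) (f : RatSpace d) :
    toMap (iterationMap d n f) = (toMap f)^[n] := by
  have key : ∀ (m : ℕ) (z : Fin 2 → ℂ) (hz : z ≠ 0),
      (toMap f)^[m] (Projectivization.mk ℂ z hz) =
        Projectivization.mk ℂ (fun j => eval z (iterForms (forms d f.1.rep) m j))
          (NoCommonZero.iterForms f.2 m z hz) := by
    intro m
    induction m with
    | zero =>
      intro z hz
      simp [iterForms]
    | succ m ih =>
      intro z hz
      obtain ⟨b, hb, hbz⟩ := ComplexProj.exists_smul_rep z hz
      have h1 : toMap f (Projectivization.mk ℂ z hz) =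
          Projectivization.mk ℂ (fun j => eval z (forms d f.1.rep j)) (f.2 z hz) := by
        rw [toMap, Projectivization.mk_eq_mk_iff']
        refine ⟨b ^ d, ?_⟩
        ext j
        simp only [hbz, Pi.smul_apply, smul_eq_mul,
          eval_smul_of_isHomogeneous (forms_isHomogeneous d f.1.rep j)]
      rw [Function.iterate_succ_apply, h1, ih]
      congr 1
      rw [eval_iterForms, eval_iterForms, Function.iterate_succ_apply]
  funext p
  induction p using Projectivization.ind with
  | h z hz =>
    rw [key, iterationMap, toMap_mk]
    congr 1
    rw [forms_coeffs (iterForms_isHomogeneous (forms_isHomogeneous d _) n)]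

end RatMap

end

/-!
Lift a rational map to a pair `P` of binary forms of degree `d` without common zero, so that its
`n`-th iterate lifts to the iterate `Pⁿ` of the polynomial map `P`. A tangent vector is a pair `G`
of forms of degree `d`, taken modulo multiples of `P`; it is recorded faithfully by the form
`wedge P G = P₀ G₁ - P₁ G₀`. Write `J`, `Jₙ` for the Jacobian determinants of `P`, `Pⁿ`, and `Wₙ`
for the wedge of `Pⁿ` with its derivative in the direction `G`. Euler's identity turns the chain
rule for `P ∘ Pⁿ` and for `Pⁿ ∘ P` into the two recursions

* `d • Wₙ₊₁ = d • (wedge P G)(Pⁿ) + J(Pⁿ) * Wₙ` (`wedge_iterVar_succ`),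
* `dⁿ • Wₙ₊₁ = dⁿ • Wₙ(P) + Jₙ(P) * wedge P G` (`wedge_iterVar_succ'`).

If `Wₙ = 0`, comparing them shows that the rational function `u = wedge P G / J`, homogeneous of
degree `2`, satisfies `dⁿ • u(Pⁿ) = Jₙ * u`: it is a meromorphic vector field on the projective line
that is invariant under pullback by a map of degree `D = dⁿ ≥ 2`. Such a field vanishes
(`no_invariant_quotient`): its polar divisor would be backward invariant with degree multiplied by
`D`, so there are no poles and `u` is a quadratic form (`no_invariant_quadratic_form`). The zeros of
`u` are backward invariant; a double zero is incompatible with the order of vanishing of the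
Jacobian, and two simple zeros force the map to be conjugate to `z ↦ z ^ (± D)`, whose invariance
equation for `z ∂/∂z` reads `1 = ± D`. Hence `wedge P G = 0`, and `G` is a multiple of `P`.

Read in affine charts, this says that the differential of the iteration map is injective
(`injective_mfderiv_iterationMap`). For finite-dimensional manifolds the inverse function theorem
then provides charts in which the map is a linear inclusion
(`ContMDiffAt.isImmersionAtOfComplement_of_injective_mfderiv`).
-/

noncomputable section

namespace RatMap

open MvPolynomial

/-! ### Zeros and divisibility of binary forms -/

/-- The linear form `a₁ x - a₀ y`, which vanishes exactly on the line spanned by `a`. -/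
def lin (a : Fin 2 → ℂ) : MvPolynomial (Fin 2) ℂ := C (a 1) * X 0 - C (a 0) * X 1

/-- The Jacobian determinant of a pair of polynomials in two variables. -/
def jac (A B : MvPolynomial (Fin 2) ℂ) : MvPolynomial (Fin 2) ℂ :=
  pderiv 0 A * pderiv 1 B - pderiv 1 A * pderiv 0 B

theorem eval_lin (a z : Fin 2 → ℂ) : eval z (lin a) = a 1 * z 0 - a 0 * z 1 := by
  simp [lin]

theorem eval_lin_self (a : Fin 2 → ℂ) : eval a (lin a) = 0 := by
  rw [eval_lin]; ring

theorem lin_isHomogeneous (a : Fin 2 → ℂ) : (lin a).IsHomogeneous 1 :=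
  ((isHomogeneous_X ℂ 0).C_mul _).sub ((isHomogeneous_X ℂ 1).C_mul _)

theorem pderiv_zero_lin (a : Fin 2 → ℂ) : pderiv 0 (lin a) = C (a 1) := by
  simp [lin, pderiv_X]

theorem pderiv_one_lin (a : Fin 2 → ℂ) : pderiv 1 (lin a) = -C (a 0) := by
  simp [lin, pderiv_X]

theorem lin_ne_zero {a : Fin 2 → ℂ} (ha : a ≠ 0) : lin a ≠ 0 := by
  intro h
  apply ha
  ext i
  fin_cases i
  · have := congrArg (coeff 0) ((pderiv_one_lin a).symm.trans (by rw [h, map_zero]))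
    simpa using this
  · have := congrArg (coeff 0) ((pderiv_zero_lin a).symm.trans (by rw [h, map_zero]))
    simpa using this

/-- `lin a` vanishes only on the line spanned by `a`. -/
theorem eq_smul_of_eval_lin {a z : Fin 2 → ℂ} (ha : a ≠ 0) (h : eval z (lin a) = 0) :
    ∃ t : ℂ, z = t • a := by
  rw [eval_lin] at h
  by_cases h0 : a 0 = 0
  · have h1 : a 1 ≠ 0 := fun h1 => ha (by ext i; fin_cases i <;> simp [h0, h1])
    refine ⟨z 1 / a 1, ?_⟩
    ext i
    fin_cases i
    · simp [h0] at h ⊢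
      tauto
    · simp [h1]
  · refine ⟨z 0 / a 0, ?_⟩
    ext i
    fin_cases i
    · simp [h0]
    · simp only [Fin.mk_one, Pi.smul_apply, smul_eq_mul]
      field_simp
      linear_combination -h

theorem eval_lin_comm (a b : Fin 2 → ℂ) : eval a (lin b) = -eval b (lin a) := by
  simp only [eval_lin]; ring

/-- The cofactor is obtained as a homogeneous component of an arbitrary one. -/
theorem exists_homogeneous_cofactor {m k : ℕ} {A B : MvPolynomial (Fin 2) ℂ}
    (hA : A.IsHomogeneous m) (hB : B.IsHomogeneous k) (hk : k ≤ m) (h : B ∣ A) :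
    ∃ Q : MvPolynomial (Fin 2) ℂ, Q.IsHomogeneous (m - k) ∧ A = B * Q := by
  obtain ⟨Q, rfl⟩ := h
  refine ⟨homogeneousComponent (m - k) Q, homogeneousComponent_isHomogeneous _ _, ?_⟩
  let := gradedAlgebra (σ := Fin 2) (R := ℂ)
  have h1 := DirectSum.coe_decompose_mul_of_left_mem_of_le (homogeneousSubmodule (Fin 2) ℂ)
    (a := B) (b := Q) hB hk
  have h2 : ∀ (i : ℕ) (p : MvPolynomial (Fin 2) ℂ),
    ((DirectSum.decompose (homogeneousSubmodule (Fin 2) ℂ) p i : _) : MvPolynomial (Fin 2) ℂ) =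
      homogeneousComponent i p := fun i p => by
    rw [← decomposition.decompose'_apply]; rfl
  rw [h2, h2, homogeneousComponent_of_mem hA, if_pos rfl] at h1
  exact h1

/-- A form vanishing at `a` is divisible by `lin a`. -/
theorem lin_dvd {m : ℕ} {A : MvPolynomial (Fin 2) ℂ} (hA : A.IsHomogeneous m) {a : Fin 2 → ℂ}
    (ha : a ≠ 0) (h : eval a A = 0) : lin a ∣ A := by
  obtain ⟨j, hj⟩ := Function.ne_iff.1 ha
  have hj : a j ≠ 0 := hj
  set φ := Ideal.Quotient.mk (Ideal.span {lin a}) with hφ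
  have hrel : φ (C (a 1)) * φ (X 0) = φ (C (a 0)) * φ (X 1) := by
    rw [← map_mul, ← map_mul, Ideal.Quotient.eq, Ideal.mem_span_singleton]
    exact dvd_rfl
  -- Modulo `lin a`, the vector `a j • (X 0, X 1)` is `X j • a`.
  have hmod : ∀ i, φ (C (a j)) * φ (X i) = φ (X j) * φ (C (a i)) := by
    intro i
    fin_cases i <;> fin_cases j
    · exact mul_comm _ _
    · change φ (C (a 1)) * φ (X 0) = φ (X 1) * φ (C (a 0))
      rw [hrel, mul_comm]
    · change φ (C (a 0)) * φ (X 1) = φ (X 0) * φ (C (a 1))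
      rw [← hrel, mul_comm]
    · exact mul_comm _ _
  have key : φ (C (a j ^ m) * A) = φ (X j ^ m * C (eval a A)) := by
    have e := eq_sum_of_isHomogeneous hA
    rw [e]
    simp only [map_sum, map_mul, map_pow, eval_C, eval_X, Finset.mul_sum]
    refine Finset.sum_congr rfl fun i _ => ?_
    have hi : m = (i : ℕ) + (m - i) := by omega
    have hp : ∀ c : MvPolynomial (Fin 2) ℂ ⧸ Ideal.span {lin a},
        c ^ m = c ^ (i : ℕ) * c ^ (m - i) := fun c => by
      rw [← pow_add, ← hi]
    calc _ = φ (C (coeff (expo m i) A)) * ((φ (C (a j)) * φ (X 0)) ^ (i : ℕ) *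
          (φ (C (a j)) * φ (X 1)) ^ (m - i)) := by
            rw [hp (φ (C (a j))), mul_pow, mul_pow]; ring
      _ = _ := by
            rw [hmod, hmod, hp (φ (X j)), mul_pow, mul_pow]; ring
  rw [h, map_zero, mul_zero, map_zero, Ideal.Quotient.eq_zero_iff_mem,
    Ideal.mem_span_singleton] at key
  have hu : IsUnit (C (a j ^ m) : MvPolynomial (Fin 2) ℂ) :=
    (isUnit_iff_ne_zero.2 (pow_ne_zero _ hj)).map C
  exact (hu.dvd_mul_left).1 key

theorem eq_C_of_isHomogeneous_zero {A : MvPolynomial (Fin 2) ℂ} (hA : A.IsHomogeneous 0) :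
    ∃ c, A = C c :=
  ⟨_, totalDegree_eq_zero_iff_eq_C.1 (Nat.le_zero.1 hA.totalDegree_le)⟩

theorem exists_eq_lin_mul {m : ℕ} {A : MvPolynomial (Fin 2) ℂ} (hA : A.IsHomogeneous (m + 1))
    {a : Fin 2 → ℂ} (ha : a ≠ 0) (h : eval a A = 0) :
    ∃ Q : MvPolynomial (Fin 2) ℂ, Q.IsHomogeneous m ∧ A = lin a * Q := by
  simpa using exists_homogeneous_cofactor hA (lin_isHomogeneous a) (by omega) (lin_dvd hA ha h)

/-- A form of positive degree has a nontrivial zero. -/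
theorem exists_zero {m : ℕ} (hm : 1 ≤ m) {A : MvPolynomial (Fin 2) ℂ} (hA : A.IsHomogeneous m) :
    ∃ a : Fin 2 → ℂ, a ≠ 0 ∧ eval a A = 0 := by
  have e := eq_sum_of_isHomogeneous hA
  by_cases hlead : coeff (expo m m) A = 0
  · refine ⟨![1, 0], fun h => one_ne_zero (congrFun h 0), ?_⟩
    rw [e]
    simp only [map_sum, map_mul, map_pow, eval_C, eval_X]
    refine Finset.sum_eq_zero fun i _ => ?_
    rcases eq_or_ne (i : ℕ) m with hi | hi
    · rw [hi, hlead, zero_mul]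
    · have : m - (i : ℕ) ≠ 0 := by omega
      simp [this]
  · let f : Polynomial ℂ :=
      ∑ i : Fin (m + 1), Polynomial.C (coeff (expo m i) A) * Polynomial.X ^ (i : ℕ)
    have hc : f.coeff m = coeff (expo m m) A := by
      simp only [f, Polynomial.finsetSum_coeff, Polynomial.coeff_C_mul, Polynomial.coeff_X_pow]
      rw [Finset.sum_eq_single (Fin.last m)]
      · simp
      · intro b _ hb
        have : m ≠ (b : ℕ) := fun h => hb (Fin.ext h.symm)
        simp [this]
      · simp
    have hdeg : f.degree ≠ 0 := by
      intro h0
      have := Polynomial.natDegree_eq_zero_iff_degree_le_zero.2 h0.le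
      exact hlead (hc ▸ Polynomial.coeff_eq_zero_of_natDegree_lt (by omega))
    obtain ⟨x, hx⟩ := IsAlgClosed.exists_root f hdeg
    refine ⟨![x, 1], fun h => one_ne_zero (congrFun h 1), ?_⟩
    rw [e]
    simpa [f, Polynomial.IsRoot, Polynomial.eval_finsetSum] using hx

theorem eval_ne_zero_of_noCommonZero {P : Fin 2 → MvPolynomial (Fin 2) ℂ} (h : NoCommonZero P)
    {z : Fin 2 → ℂ} (hz : z ≠ 0) : ¬ (eval z (P 0) = 0 ∧ eval z (P 1) = 0) := by
  rintro ⟨h0, h1⟩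
  exact h z hz (by ext j; fin_cases j <;> assumption)

/-- Forms without common zero are coprime: the linear factors of `A` can be cancelled one at a
time. -/
theorem dvd_of_dvd_mul_of_no_common_zero {m l : ℕ} {A B D : MvPolynomial (Fin 2) ℂ}
    (hA : A.IsHomogeneous m) (hD : D.IsHomogeneous l)
    (h0 : ∀ z : Fin 2 → ℂ, z ≠ 0 → eval z A = 0 → eval z B ≠ 0) (h : A ∣ B * D) : A ∣ D := by
  induction m generalizing A D l with
  | zero =>
    obtain ⟨c, rfl⟩ := eq_C_of_isHomogeneous_zero hA
    by_cases hc : c = 0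
    · subst hc
      rw [map_zero, zero_dvd_iff, mul_eq_zero] at h
      rcases h with h | h
      · exact absurd (by rw [h, map_zero]) (h0 (fun _ => 1)
          (fun hz => one_ne_zero (α := ℂ) (congrFun hz 0)) (by simp))
      · rw [h]; exact dvd_zero _
    · exact ((isUnit_iff_ne_zero.2 hc).map C).dvd
  | succ m ih =>
    obtain ⟨a, ha, haA⟩ := exists_zero (by omega) hA
    obtain ⟨A', hA', rfl⟩ := exists_eq_lin_mul hA ha haA
    have hBa := h0 a ha haA
    have hDa : eval a D = 0 := by
      obtain ⟨Q, hQ⟩ := h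
      have := congrArg (eval a) hQ
      simp only [map_mul, eval_lin_self, zero_mul] at this
      exact (mul_eq_zero.1 this).resolve_left hBa
    rcases l with _ | l
    · obtain ⟨c, rfl⟩ := eq_C_of_isHomogeneous_zero hD
      rw [eval_C] at hDa
      rw [hDa, map_zero]
      exact dvd_zero _
    obtain ⟨D', hD', rfl⟩ := exists_eq_lin_mul hD ha hDa
    refine mul_dvd_mul_left _ (ih hA' hD' ?_ ?_)
    · intro z hz hzA
      exact h0 z hz (by rw [map_mul, hzA, mul_zero])
    · rw [mul_left_comm] at h
      exact (mul_dvd_mul_iff_left (lin_ne_zero ha)).1 h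

/-- Factoring out the exact multiplicity `e` of a form along the line of `a`. -/
theorem exists_eq_lin_pow_mul {m : ℕ} {A : MvPolynomial (Fin 2) ℂ} (hA : A.IsHomogeneous m)
    (hA0 : A ≠ 0) {a : Fin 2 → ℂ} (ha : a ≠ 0) :
    ∃ (e k : ℕ) (Q : MvPolynomial (Fin 2) ℂ), e + k = m ∧ Q.IsHomogeneous k ∧
      A = lin a ^ e * Q ∧ eval a Q ≠ 0 := by
  induction m generalizing A with
  | zero =>
    obtain ⟨c, rfl⟩ := eq_C_of_isHomogeneous_zero hA
    refine ⟨0, 0, C c, rfl, hA, by simp, ?_⟩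
    simpa using hA0
  | succ m ih =>
    by_cases h : eval a A = 0
    · obtain ⟨A', hA', rfl⟩ := exists_eq_lin_mul hA ha h
      obtain ⟨e, k, Q, hek, hQ, rfl, hQa⟩ := ih hA' (right_ne_zero_of_mul hA0)
      exact ⟨e + 1, k, Q, by omega, hQ, by ring, hQa⟩
    · exact ⟨0, m + 1, A, by omega, hA, by simp, h⟩

/-- A form whose zeros all lie on one line is a multiple of a power of a linear form. -/
theorem eq_C_mul_lin_pow {m : ℕ} {A : MvPolynomial (Fin 2) ℂ} (hA : A.IsHomogeneous m)
    (hA0 : A ≠ 0) {a : Fin 2 → ℂ} (ha : a ≠ 0)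
    (h : ∀ z : Fin 2 → ℂ, z ≠ 0 → eval z A = 0 → eval z (lin a) = 0) :
    ∃ c : ℂ, c ≠ 0 ∧ A = C c * lin a ^ m := by
  obtain ⟨e, k, Q, hek, hQ, rfl, hQa⟩ := exists_eq_lin_pow_mul hA hA0 ha
  rcases k with _ | k
  · obtain ⟨c, rfl⟩ := eq_C_of_isHomogeneous_zero hQ
    refine ⟨c, by simpa using hQa, ?_⟩
    rw [← hek, add_zero, mul_comm]
  · obtain ⟨z, hz, hzQ⟩ := exists_zero (by omega) hQ
    obtain ⟨t, rfl⟩ := eq_smul_of_eval_lin ha (h z hz (by rw [map_mul, hzQ, mul_zero]))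
    have ht : t ≠ 0 := by rintro rfl; simp at hz
    rw [eval_smul_of_isHomogeneous hQ] at hzQ
    exact absurd hzQ (mul_ne_zero (pow_ne_zero _ ht) hQa)

/-! ### Jacobian determinants of pairs of binary forms -/

/-- Euler's identity for binary forms. -/
theorem euler {m : ℕ} {A : MvPolynomial (Fin 2) ℂ} (hA : A.IsHomogeneous m) :
    X 0 * pderiv 0 A + X 1 * pderiv 1 A = C (m : ℂ) * A := by
  have := hA.sum_X_mul_pderiv
  rw [Fin.sum_univ_two, nsmul_eq_mul] at this
  rw [this]; simp

theorem eval_euler {m : ℕ} {A : MvPolynomial (Fin 2) ℂ} (hA : A.IsHomogeneous m) (z : Fin 2 → ℂ) :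
    z 0 * eval z (pderiv 0 A) + z 1 * eval z (pderiv 1 A) = m * eval z A := by
  simpa using congrArg (eval z) (euler hA)

theorem jac_isHomogeneous {m k : ℕ} {A B : MvPolynomial (Fin 2) ℂ} (hA : A.IsHomogeneous m)
    (hB : B.IsHomogeneous k) : (jac A B).IsHomogeneous (m - 1 + (k - 1)) :=
  (hA.pderiv.mul hB.pderiv).sub (hA.pderiv.mul hB.pderiv)

/-- If `A = lin a ^ e * A'` vanishes to order exactly `e ≥ 1` along the line of `a` and `B` does not
vanish there, then the Jacobian of `A` and `B` vanishes only to order `e - 1`: by Euler's identity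
`jac (lin a) B` takes the value `k * B a ≠ 0` at `a`, where `k` is the degree of `B`. -/
theorem not_lin_pow_dvd_jac {k : ℕ} (hk : 1 ≤ k) {A' B : MvPolynomial (Fin 2) ℂ}
    (hB : B.IsHomogeneous k) {a : Fin 2 → ℂ} (ha : a ≠ 0) (hA'a : eval a A' ≠ 0)
    (hBa : eval a B ≠ 0) {e : ℕ} (he : 1 ≤ e) : ¬ lin a ^ e ∣ jac (lin a ^ e * A') B := by
  obtain ⟨e, rfl⟩ : ∃ e', e = e' + 1 := ⟨e - 1, by omega⟩
  have hj : jac (lin a ^ (e + 1) * A') B =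
      lin a ^ e * (C ((e : ℂ) + 1) * A' * jac (lin a) B + lin a * jac A' B) := by
    simp only [jac, pderiv_mul, pderiv_pow, Nat.add_sub_cancel, map_add, map_natCast, map_one]
    push_cast
    ring
  rw [hj, pow_succ, mul_dvd_mul_iff_left (pow_ne_zero _ (lin_ne_zero ha))]
  rintro ⟨Q, hQ⟩
  have h1 := congrArg (eval a) hQ
  have h2 := eval_euler hB a
  simp only [jac, pderiv_zero_lin, pderiv_one_lin, map_add, map_mul, map_sub, map_neg, eval_C,
    eval_lin_self, zero_mul, add_zero] at h1
  have h3 : ((e : ℂ) + 1) * eval a A' * (k * eval a B) = 0 := by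
    rw [← h2]; linear_combination h1
  have h4 : (e : ℂ) + 1 ≠ 0 := by exact_mod_cast e.succ_ne_zero
  have h5 : (k : ℂ) ≠ 0 := by exact_mod_cast (by omega : k ≠ 0)
  exact mul_ne_zero (mul_ne_zero h4 hA'a) (mul_ne_zero h5 hBa) h3

theorem NoCommonZero.ne_zero {m : ℕ} (hm : 1 ≤ m) {P : Fin 2 → MvPolynomial (Fin 2) ℂ}
    (hP : ∀ j, (P j).IsHomogeneous m) (h : NoCommonZero P) (j : Fin 2) : P j ≠ 0 := by
  intro hj
  obtain ⟨z, hz, hz0⟩ := exists_zero hm (hP (1 - j))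
  refine h z hz (funext fun i => ?_)
  rcases eq_or_ne i j with rfl | hij
  · simp [hj]
  · obtain rfl : i = 1 - j := by fin_cases i <;> fin_cases j <;> simp_all
    exact hz0

/-- A nondegenerate pair of forms has nonzero Jacobian: it is seen along a zero of the first
component. -/
theorem NoCommonZero.jac_ne_zero {m : ℕ} (hm : 1 ≤ m) {P : Fin 2 → MvPolynomial (Fin 2) ℂ}
    (hP : ∀ j, (P j).IsHomogeneous m) (h : NoCommonZero P) : jac (P 0) (P 1) ≠ 0 := by
  obtain ⟨a, ha, ha0⟩ := exists_zero hm (hP 0)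
  obtain ⟨e, k, Q, -, hQ, hPQ, hQa⟩ := exists_eq_lin_pow_mul (hP 0) (h.ne_zero hm hP 0) ha
  have he : 1 ≤ e := by
    rcases Nat.eq_zero_or_pos e with rfl | he
    · rw [hPQ, pow_zero, one_mul] at ha0
      exact absurd ha0 hQa
    · exact he
  intro hJ
  refine not_lin_pow_dvd_jac hm (hP 1) ha hQa (fun h1 => ?_) he (by rw [← hPQ, hJ]; exact dvd_zero _)
  exact eval_ne_zero_of_noCommonZero h ha ⟨ha0, h1⟩

theorem eval_bind₁' (H : Fin 2 → MvPolynomial (Fin 2) ℂ) (A : MvPolynomial (Fin 2) ℂ)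
    (z : Fin 2 → ℂ) : eval z (bind₁ H A) = eval (fun j => eval z (H j)) A := by
  rw [← aeval_eq_bind₁]
  simpa [coe_aeval_eq_eval] using aeval_bind₁ z H A

/-- The chain rule. -/
theorem pderiv_bind₁ (H : Fin 2 → MvPolynomial (Fin 2) ℂ) (A : MvPolynomial (Fin 2) ℂ)
    (i : Fin 2) : pderiv i (bind₁ H A) =
      bind₁ H (pderiv 0 A) * pderiv i (H 0) + bind₁ H (pderiv 1 A) * pderiv i (H 1) := by
  induction A using MvPolynomial.induction_on with
  | C c => simp
  | add p q hp hq => simp only [map_add, hp, hq]; ring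
  | mul_X p j hp =>
    simp only [map_mul, pderiv_mul, hp, bind₁_X_right, map_add]
    fin_cases j <;> simp [pderiv_X] <;> ring

theorem jac_bind₁ (H : Fin 2 → MvPolynomial (Fin 2) ℂ) (A B : MvPolynomial (Fin 2) ℂ) :
    jac (bind₁ H A) (bind₁ H B) = bind₁ H (jac A B) * jac (H 0) (H 1) := by
  simp only [jac, pderiv_bind₁, map_sub, map_mul]
  ring

theorem bind₁_lin (H : Fin 2 → MvPolynomial (Fin 2) ℂ) (a : Fin 2 → ℂ) :
    bind₁ H (lin a) = C (a 1) * H 0 - C (a 0) * H 1 := by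
  simp [lin]

/-! ### Invariant vector fields on the projective line -/

section

variable {D : ℕ} {H : Fin 2 → MvPolynomial (Fin 2) ℂ}

/-- A nondegenerate pair of forms is dominant. -/
theorem NoCommonZero.bind₁_ne_zero {m : ℕ} (hD : 1 ≤ D) (hH : ∀ j, (H j).IsHomogeneous D)
    (h : NoCommonZero H) {A : MvPolynomial (Fin 2) ℂ} (hA : A.IsHomogeneous m) (hA0 : A ≠ 0) :
    bind₁ H A ≠ 0 := by
  induction m generalizing A with
  | zero =>
    obtain ⟨c, rfl⟩ := eq_C_of_isHomogeneous_zero hA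
    simpa using hA0
  | succ m ih =>
    obtain ⟨a, ha, haA⟩ := exists_zero (by omega) hA
    obtain ⟨Q, hQ, rfl⟩ := exists_eq_lin_mul hA ha haA
    rw [map_mul]
    refine mul_ne_zero (fun h0 => ?_) (ih hQ (right_ne_zero_of_mul hA0))
    obtain ⟨j, hj⟩ := Function.ne_iff.1 ha
    have hj : a j ≠ 0 := hj
    -- A zero of the component `H j` would be a zero of the other component as well.
    obtain ⟨z, hz, hz0⟩ := exists_zero hD (hH j)
    have h1 := congrArg (eval z) h0
    simp only [bind₁_lin, map_sub, map_mul, eval_C, map_zero] at h1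
    apply eval_ne_zero_of_noCommonZero h hz
    fin_cases j
    · simp only [Fin.zero_eta] at hz0 hj
      rw [hz0] at h1
      simpa [hz0, hj] using h1
    · simp only [Fin.mk_one] at hz0 hj
      rw [hz0] at h1
      simpa [hz0, hj] using h1

/-- If `lin a ∘ H` vanishes to order exactly `e ≥ 1` along the line of `z`, then the Jacobian of `H`
does not vanish to order `e` there. -/
theorem not_lin_pow_dvd_jac_of_bind₁_lin (hD : 1 ≤ D) (hH : ∀ j, (H j).IsHomogeneous D)
    (h : NoCommonZero H) {a z : Fin 2 → ℂ} (ha : a ≠ 0) (hz : z ≠ 0) {e : ℕ} (he : 1 ≤ e)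
    {Q : MvPolynomial (Fin 2) ℂ} (hQ : bind₁ H (lin a) = lin z ^ e * Q) (hQz : eval z Q ≠ 0) :
    ¬ lin z ^ e ∣ jac (H 0) (H 1) := by
  intro hdvd
  have hzero : eval (fun j => eval z (H j)) (lin a) = 0 := by
    rw [← eval_bind₁', hQ, map_mul, map_pow, eval_lin_self, zero_pow (by omega), zero_mul]
  obtain ⟨t, ht⟩ := eq_smul_of_eval_lin ha hzero
  have ht0 : t ≠ 0 := by
    rintro rfl
    exact h z hz (by rw [ht, zero_smul])
  obtain ⟨j, hj⟩ := Function.ne_iff.1 ha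
  have hj : a j ≠ 0 := hj
  refine not_lin_pow_dvd_jac hD (hH j) hz hQz ?_ he (A' := Q) ?_
  · have := congrFun ht j
    rw [this]
    exact mul_ne_zero ht0 hj
  · rw [← hQ, bind₁_lin]
    have : jac (C (a 1) * H 0 - C (a 0) * H 1) (H j) = C (a j) * jac (H 0) (H 1) := by
      fin_cases j <;> simp [jac] <;> ring
    rw [this]
    exact hdvd.mul_left _

/-- There is no nonzero quadratic form `N` with `D • N(H) = jac H * N`. In other words, a rational
map of degree `D ≥ 2` preserves no nonzero holomorphic vector field on the projective line. -/
theorem no_invariant_quadratic_form (hD : 2 ≤ D) (hH : ∀ j, (H j).IsHomogeneous D)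
    (h : NoCommonZero H) {N : MvPolynomial (Fin 2) ℂ} (hN : N.IsHomogeneous 2) (hN0 : N ≠ 0) :
    C (D : ℂ) * bind₁ H N ≠ jac (H 0) (H 1) * N := by
  intro hrel
  have hD0 : (D : ℂ) ≠ 0 := by exact_mod_cast (by omega : D ≠ 0)
  have hA : ∀ a, (bind₁ H (lin a)).IsHomogeneous D := fun a => by
    simpa using (lin_isHomogeneous a).aeval H hH
  have hA0 : ∀ a, a ≠ 0 → bind₁ H (lin a) ≠ 0 := fun a ha =>
    h.bind₁_ne_zero (by omega) hH (lin_isHomogeneous a) (lin_ne_zero ha)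
  -- The zeros of `N` are backward invariant. If `a = H z` is a zero of `N` and `z` is not, the
  -- relation makes the order of the Jacobian at `z` at least the order `e` of `lin a ∘ H` there.
  have hback : ∀ z : Fin 2 → ℂ, z ≠ 0 → eval (fun j => eval z (H j)) N = 0 → eval z N = 0 := by
    intro z hz hHz
    by_contra hNz
    obtain ⟨N', hN', hNN'⟩ := exists_eq_lin_mul hN (h z hz) hHz
    obtain ⟨e, k, Q, -, hQ, hAQ, hQz⟩ := exists_eq_lin_pow_mul (hA _) (hA0 _ (h z hz)) hz
    have he : 1 ≤ e := by
      rcases Nat.eq_zero_or_pos e with rfl | he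
      · have : eval z (bind₁ H (lin fun j => eval z (H j))) = 0 := by
          rw [eval_bind₁', eval_lin_self]
        rw [hAQ, pow_zero, one_mul] at this
        exact absurd this hQz
      · exact he
    refine not_lin_pow_dvd_jac_of_bind₁_lin (by omega) hH h (h z hz) hz he hAQ hQz ?_
    refine dvd_of_dvd_mul_of_no_common_zero (B := N) ((lin_isHomogeneous z).pow e)
      (jac_isHomogeneous (hH 0) (hH 1)) ?_ ?_
    · intro w hw hw0
      rw [map_pow] at hw0
      obtain ⟨t, rfl⟩ := eq_smul_of_eval_lin hz (pow_eq_zero_iff (by omega) |>.1 hw0)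
      have ht : t ≠ 0 := by rintro rfl; simp at hw
      rw [eval_smul_of_isHomogeneous hN]
      exact mul_ne_zero (pow_ne_zero _ ht) hNz
    · rw [mul_comm N, ← hrel, hNN', map_mul, hAQ]
      exact ⟨C (D : ℂ) * (Q * bind₁ H N'), by ring⟩
  obtain ⟨a, ha, haN⟩ := exists_zero (by omega) hN
  obtain ⟨q, hq, rfl⟩ := exists_eq_lin_mul hN ha haN
  obtain ⟨b, hb, hbq⟩ := exists_zero (by omega) hq
  obtain ⟨r, hr, rfl⟩ := exists_eq_lin_mul hq hb hbq
  obtain ⟨c, rfl⟩ := eq_C_of_isHomogeneous_zero hr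
  have hc : (C c : MvPolynomial (Fin 2) ℂ) ≠ 0 := right_ne_zero_of_mul (right_ne_zero_of_mul hN0)
  have hrel' : C (D : ℂ) * (bind₁ H (lin a) * bind₁ H (lin b)) =
      jac (H 0) (H 1) * (lin a * lin b) := by
    apply mul_right_cancel₀ hc
    simp only [map_mul, bind₁_C_right] at hrel
    linear_combination hrel
  have hcase : ∀ z : Fin 2 → ℂ, z ≠ 0 →
      eval z (bind₁ H (lin a)) = 0 ∨ eval z (bind₁ H (lin b)) = 0 →
      eval z (lin a) = 0 ∨ eval z (lin b) = 0 := by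
    intro z hz hz0
    have := hback z hz (by
      rw [eval_bind₁', eval_bind₁'] at hz0
      rcases hz0 with h1 | h1 <;> simp [h1])
    have hc' : c ≠ 0 := by simpa using hc
    simpa [hc'] using this
  by_cases hab : eval b (lin a) = 0
  · -- A double zero: the line of `a` is totally ramified, which contradicts the order of the
    -- Jacobian prescribed by the relation.
    obtain ⟨t, rfl⟩ := eq_smul_of_eval_lin ha hab
    have ht : t ≠ 0 := by rintro rfl; simp at hb
    have hlin : lin (t • a) = C t * lin a := by simp [lin]; ring
    rw [hlin] at hcase hrel'
    obtain ⟨α, hα, hAα⟩ := eq_C_mul_lin_pow (hA a) (hA0 a ha) ha (fun z hz hz0 => by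
      simpa [ht] using hcase z hz (Or.inl hz0))
    refine not_lin_pow_dvd_jac_of_bind₁_lin (by omega) hH h ha ha (e := D) (by omega)
      (Q := C α) (by rw [hAα, mul_comm]) (by simpa using hα) ?_
    have hne : C t * lin a ^ 2 ≠ 0 := mul_ne_zero (by simpa using ht) (pow_ne_zero _ (lin_ne_zero ha))
    rw [← mul_dvd_mul_iff_right hne]
    refine ⟨C (D : ℂ) * C α ^ 2 * lin a ^ (D - 2), ?_⟩
    have hpow : lin a ^ D = lin a ^ (D - 2) * lin a ^ 2 := by rw [← pow_add]; congr 1; omega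
    rw [map_mul, bind₁_C_right, hAα] at hrel'
    calc _ = jac (H 0) (H 1) * (lin a * (C t * lin a)) := by ring
      _ = C (D : ℂ) * C α ^ 2 * C t * lin a ^ D * lin a ^ D := by rw [← hrel']; ring
      _ = _ := by rw [hpow]; ring
  · -- Two simple zeros: both lines are totally ramified, so `H` is conjugate to
    -- `(x ^ D, y ^ D)` or `(y ^ D, x ^ D)`.
    have hnot : ∀ z : Fin 2 → ℂ, z ≠ 0 → eval z (bind₁ H (lin a)) = 0 →
        eval z (bind₁ H (lin b)) ≠ 0 := by
      intro z hz h1 h2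
      rw [eval_bind₁'] at h1 h2
      obtain ⟨t, ht⟩ := eq_smul_of_eval_lin ha h1
      have ht0 : t ≠ 0 := by
        rintro rfl
        exact h z hz (by rw [ht, zero_smul])
      rw [ht, eval_smul_of_isHomogeneous (lin_isHomogeneous b), eval_lin_comm] at h2
      exact mul_ne_zero (pow_ne_zero _ ht0) (neg_ne_zero.2 hab) h2
    have hba : eval a (lin b) ≠ 0 := by rw [eval_lin_comm]; exact neg_ne_zero.2 hab
    have hpar : ∀ p z : Fin 2 → ℂ, p ≠ 0 → z ≠ 0 → eval z (lin p) = 0 →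
        ∀ {A : MvPolynomial (Fin 2) ℂ}, A.IsHomogeneous D → eval z A = 0 → eval p A = 0 := by
      intro p z hp hz hzp A hA hzA
      obtain ⟨t, rfl⟩ := eq_smul_of_eval_lin hp hzp
      have ht : t ≠ 0 := by rintro rfl; simp at hz
      rw [eval_smul_of_isHomogeneous hA] at hzA
      exact (mul_eq_zero.1 hzA).resolve_left (pow_ne_zero _ ht)
    -- The relation compared with the chain rule for the Jacobian; `s = -1` when `H` exchanges the
    -- two lines.
    have hfinal : ∀ (p q : Fin 2 → ℂ) (α β : ℂ) (s : ℂ), (s = 1 ∨ s = -1) → p ≠ 0 → q ≠ 0 →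
        α ≠ 0 → β ≠ 0 → lin p * lin q = lin a * lin b →
        jac (lin p) (lin q) = C s * jac (lin a) (lin b) →
        bind₁ H (lin a) = C α * lin p ^ D → bind₁ H (lin b) = C β * lin q ^ D → False := by
      intro p q α β s hs hp hq hα hβ hpq hjpq hAp hBq
      have hκ : jac (lin a) (lin b) = C (eval a (lin b)) := by
        simp only [jac, pderiv_zero_lin, pderiv_one_lin, eval_lin, map_sub, map_mul]; ring
      have h1 := jac_bind₁ H (lin a) (lin b)
      have h2 : jac (C α * lin p ^ D) (C β * lin q ^ D) =
          C α * C β * C (D : ℂ) ^ 2 * (lin p * lin q) ^ (D - 1) * jac (lin p) (lin q) := by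
        simp only [jac, pderiv_C_mul, pderiv_pow, map_natCast]
        ring
      rw [hAp, hBq] at h1 hrel'
      rw [h2, hjpq, hκ, bind₁_C_right] at h1
      have hpow : lin p ^ D * lin q ^ D = (lin p * lin q) ^ (D - 1) * (lin p * lin q) := by
        rw [← mul_pow, ← pow_succ]; congr 1; omega
      -- The common factor of the two sides, to be cancelled.
      have hX : C α * C β * C (D : ℂ) * (lin p * lin q) ^ (D - 1) * C (eval a (lin b)) *
          (lin p * lin q) ≠ 0 := by
        have : ∀ x : ℂ, x ≠ 0 → (C x : MvPolynomial (Fin 2) ℂ) ≠ 0 := fun x hx => by simpa using hx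
        have hl := mul_ne_zero (lin_ne_zero hp) (lin_ne_zero hq)
        exact mul_ne_zero (mul_ne_zero (mul_ne_zero (mul_ne_zero (mul_ne_zero (this _ hα) (this _ hβ))
          (this _ hD0)) (pow_ne_zero _ hl)) (this _ hba)) hl
      have h3 : (C ((D : ℂ) * s) : MvPolynomial (Fin 2) ℂ) = 1 := by
        apply mul_left_cancel₀ hX
        rw [map_mul]
        linear_combination lin p * lin q * h1 - C (eval a (lin b)) * hrel' +
          C (eval a (lin b)) * C (D : ℂ) * C α * C β * hpow +
          C (eval a (lin b)) * jac (H 0) (H 1) * hpq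
      have h4 : (D : ℂ) * s = 1 := by
        rw [← C_1] at h3
        exact C_injective _ _ h3
      rcases hs with rfl | rfl
      · have : D = 1 := by exact_mod_cast (by simpa using h4 : (D : ℂ) = 1)
        omega
      · have h5 : ((D + 1 : ℕ) : ℂ) = 0 := by push_cast; linear_combination -h4
        exact absurd h5 (Nat.cast_ne_zero.2 (by omega))
    obtain ⟨z, hz, hzA⟩ := exists_zero (by omega) (hA a)
    obtain ⟨w, hw, hwB⟩ := exists_zero (by omega) (hA b)
    rcases hcase z hz (Or.inl hzA) with hza | hzb
    · have haA := hpar a z ha hz hza (hA a) hzA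
      have haB := hnot a ha haA
      have hbB : eval b (bind₁ H (lin b)) = 0 := by
        rcases hcase w hw (Or.inr hwB) with hwa | hwb
        · exact absurd (hpar a w ha hw hwa (hA b) hwB) haB
        · exact hpar b w hb hw hwb (hA b) hwB
      obtain ⟨α, hα, hAα⟩ := eq_C_mul_lin_pow (hA a) (hA0 a ha) ha (fun z hz hz0 =>
        (hcase z hz (Or.inl hz0)).resolve_right fun h1 =>
          hnot b hb (hpar b z hb hz h1 (hA a) hz0) hbB)
      obtain ⟨β, hβ, hBβ⟩ := eq_C_mul_lin_pow (hA b) (hA0 b hb) hb (fun z hz hz0 =>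
        (hcase z hz (Or.inr hz0)).resolve_left fun h1 =>
          haB (hpar a z ha hz h1 (hA b) hz0))
      exact hfinal a b α β 1 (Or.inl rfl) ha hb hα hβ rfl (by simp) hAα hBβ
    · have hbA := hpar b z hb hz hzb (hA a) hzA
      have hbB := hnot b hb hbA
      have haB : eval a (bind₁ H (lin b)) = 0 := by
        rcases hcase w hw (Or.inr hwB) with hwa | hwb
        · exact hpar a w ha hw hwa (hA b) hwB
        · exact absurd (hpar b w hb hw hwb (hA b) hwB) hbB
      obtain ⟨α, hα, hAα⟩ := eq_C_mul_lin_pow (hA a) (hA0 a ha) hb (fun z hz hz0 =>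
        (hcase z hz (Or.inl hz0)).resolve_left fun h1 =>
          hnot a ha (hpar a z ha hz h1 (hA a) hz0) haB)
      obtain ⟨β, hβ, hBβ⟩ := eq_C_mul_lin_pow (hA b) (hA0 b hb) ha (fun z hz hz0 =>
        (hcase z hz (Or.inr hz0)).resolve_right fun h1 =>
          hbB (hpar b z hb hz h1 (hA b) hz0))
      exact hfinal b a α β (-1) (Or.inr rfl) hb ha hα hβ (mul_comm _ _)
        (by simp only [jac, map_neg, map_one]; ring) hAα hBβ

/-- There is no nonzero pair of forms `N`, `M` of degrees `k + 2` and `k` whose quotient `u = N / M`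
satisfies `D • u(H) = jac H * u`. In other words, a rational map of degree `D ≥ 2` preserves no
nonzero meromorphic vector field on the projective line. -/
theorem no_invariant_quotient (hD : 2 ≤ D) (hH : ∀ j, (H j).IsHomogeneous D)
    (h : NoCommonZero H) {k : ℕ} {N M : MvPolynomial (Fin 2) ℂ} (hN : N.IsHomogeneous (k + 2))
    (hM : M.IsHomogeneous k) (hN0 : N ≠ 0) (hM0 : M ≠ 0) :
    C (D : ℂ) * bind₁ H N * M ≠ jac (H 0) (H 1) * N * bind₁ H M := by
  intro hrel
  induction k generalizing N M with
  | zero =>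
    obtain ⟨c, rfl⟩ := eq_C_of_isHomogeneous_zero hM
    refine no_invariant_quadratic_form hD hH h hN hN0 (mul_right_cancel₀ hM0 ?_)
    rwa [bind₁_C_right] at hrel
  | succ k ih =>
    by_cases hz : ∃ z : Fin 2 → ℂ, z ≠ 0 ∧ eval z N = 0 ∧ eval z M = 0
    · -- Cancel a common factor.
      obtain ⟨z, hz, hzN, hzM⟩ := hz
      obtain ⟨N', hN', rfl⟩ := exists_eq_lin_mul (m := k + 2) hN hz hzN
      obtain ⟨M', hM', rfl⟩ := exists_eq_lin_mul hM hz hzM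
      refine ih hN' hM' (right_ne_zero_of_mul hN0) (right_ne_zero_of_mul hM0) ?_
      have hl := mul_ne_zero (lin_ne_zero hz)
        (h.bind₁_ne_zero (by omega) hH (lin_isHomogeneous z) (lin_ne_zero hz))
      apply mul_left_cancel₀ hl
      simp only [map_mul] at hrel
      linear_combination hrel
    · -- Otherwise `M(H)` divides `M`, which is absurd for degree reasons.
      push Not at hz
      have hMH := hM.aeval H hH
      have hD0 : (D : ℂ) ≠ 0 := by exact_mod_cast (by omega : D ≠ 0)
      have hdvd : bind₁ H M ∣ M := by
        refine dvd_of_dvd_mul_of_no_common_zero (B := C (D : ℂ) * bind₁ H N) hMH hM ?_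
          ⟨jac (H 0) (H 1) * N, by rw [hrel]; ring⟩
        intro z hz0 hzM hzN
        rw [map_mul, eval_C, mul_eq_zero] at hzN
        change eval z (bind₁ H M) = 0 at hzM
        rw [eval_bind₁'] at hzM hzN
        exact hz _ (h z hz0) (hzN.resolve_left hD0) hzM
      obtain ⟨Q, hQ⟩ := hdvd
      have hMH0 : bind₁ H M ≠ 0 := h.bind₁_ne_zero (by omega) hH hM hM0
      have hdeg := congrArg totalDegree hQ
      rw [totalDegree_mul_of_isDomain hMH0 (by rintro rfl; exact hM0 (by simpa using hQ)),
        hM.totalDegree hM0] at hdeg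
      have h1 : (bind₁ H M).totalDegree = D * (k + 1) := hMH.totalDegree hMH0
      rw [h1] at hdeg
      nlinarith

end

/-! ### The derivative of an iterate, up to scaling -/

/-- `iterForms` is defined through `Pⁿ⁺¹ = Pⁿ ∘ P`; this is `Pⁿ⁺¹ = P ∘ Pⁿ`. -/
theorem iterForms_succ' (P : Fin 2 → MvPolynomial (Fin 2) ℂ) (n : ℕ) (j : Fin 2) :
    iterForms P (n + 1) j = bind₁ (iterForms P n) (P j) := by
  apply MvPolynomial.funext
  intro z
  rw [eval_bind₁', eval_iterForms]
  have := congrFun (eval_iterForms P (n + 1) z) j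
  rwa [Function.iterate_succ_apply'] at this

/-- The derivative of the `n`-th iterate of a pair of forms `P` when `P` moves in the direction
`G`. The recursion differentiates `P ∘ Pⁿ`. -/
def iterVar (P G : Fin 2 → MvPolynomial (Fin 2) ℂ) : ℕ → Fin 2 → MvPolynomial (Fin 2) ℂ
  | 0 => 0
  | n + 1 => fun j => bind₁ (iterForms P n) (G j) +
      (bind₁ (iterForms P n) (pderiv 0 (P j)) * iterVar P G n 0 +
        bind₁ (iterForms P n) (pderiv 1 (P j)) * iterVar P G n 1)

/-- The form `P ∧ G`, representing the tangent vector `G` to the space of rational maps at `P`,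
taken modulo multiples of `P`, as a section of the pullback of the tangent bundle of the
projective line. -/
def wedge (P G : Fin 2 → MvPolynomial (Fin 2) ℂ) : MvPolynomial (Fin 2) ℂ :=
  P 0 * G 1 - P 1 * G 0

section
variable {d : ℕ} {P G : Fin 2 → MvPolynomial (Fin 2) ℂ}

/-- The derivative of `P ∘ Pⁿ`, wedged with `Pⁿ⁺¹`. By Euler's identity `d • Pⁿ⁺¹` is the Jacobian
matrix of `P` at `Pⁿ` applied to `Pⁿ`, whence the determinant in the second term. -/
theorem wedge_iterVar_succ (hP : ∀ j, (P j).IsHomogeneous d) (n : ℕ) :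
    C (d : ℂ) * wedge (iterForms P (n + 1)) (iterVar P G (n + 1)) =
      C (d : ℂ) * bind₁ (iterForms P n) (wedge P G) +
        bind₁ (iterForms P n) (jac (P 0) (P 1)) * wedge (iterForms P n) (iterVar P G n) := by
  have he : ∀ j, iterForms P n 0 * bind₁ (iterForms P n) (pderiv 0 (P j)) +
      iterForms P n 1 * bind₁ (iterForms P n) (pderiv 1 (P j)) =
        C (d : ℂ) * bind₁ (iterForms P n) (P j) := fun j => by
    simpa using congrArg (bind₁ (iterForms P n)) (euler (hP j))
  simp only [wedge, iterForms_succ', iterVar, jac, map_sub, map_mul]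
  linear_combination
    (-(bind₁ (iterForms P n) (pderiv 0 (P 1)) * iterVar P G n 0 +
        bind₁ (iterForms P n) (pderiv 1 (P 1)) * iterVar P G n 1)) * he 0 +
    (bind₁ (iterForms P n) (pderiv 0 (P 0)) * iterVar P G n 0 +
        bind₁ (iterForms P n) (pderiv 1 (P 0)) * iterVar P G n 1) * he 1

theorem jac_iterForms_succ (n : ℕ) :
    jac (iterForms P (n + 1) 0) (iterForms P (n + 1) 1) =
      bind₁ (iterForms P n) (jac (P 0) (P 1)) * jac (iterForms P n 0) (iterForms P n 1) := by
  rw [iterForms_succ', iterForms_succ', jac_bind₁]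

theorem jac_iterForms_succ' (n : ℕ) :
    jac (iterForms P (n + 1) 0) (iterForms P (n + 1) 1) =
      bind₁ P (jac (iterForms P n 0) (iterForms P n 1)) * jac (P 0) (P 1) :=
  jac_bind₁ _ _ _

theorem bind₁_iterForms_succ (n : ℕ) (A : MvPolynomial (Fin 2) ℂ) :
    bind₁ (iterForms P (n + 1)) A = bind₁ P (bind₁ (iterForms P n) A) := by
  rw [bind₁_bind₁]
  rfl

/-- The counterpart of `wedge_iterVar_succ` that corresponds to differentiating `Pⁿ ∘ P`. -/
theorem wedge_iterVar_succ' (hP : ∀ j, (P j).IsHomogeneous d) (n : ℕ) :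
    C (d : ℂ) ^ n * wedge (iterForms P (n + 1)) (iterVar P G (n + 1)) =
      C (d : ℂ) ^ n * bind₁ P (wedge (iterForms P n) (iterVar P G n)) +
        bind₁ P (jac (iterForms P n 0) (iterForms P n 1)) * wedge P G := by
  induction n with
  | zero => simp [wedge, iterVar, iterForms, jac, pderiv_X]
  | succ n ih =>
    have h1 := wedge_iterVar_succ (G := G) hP (n + 1)
    have h2 := congrArg (bind₁ P) (wedge_iterVar_succ (G := G) hP n)
    rw [bind₁_iterForms_succ, bind₁_iterForms_succ] at h1
    simp only [map_add, map_mul, bind₁_C_right] at h2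
    rw [jac_iterForms_succ n, map_mul]
    linear_combination C (d : ℂ) ^ n * h1 - C (d : ℂ) ^ n * h2 +
      bind₁ P (bind₁ (iterForms P n) (jac (P 0) (P 1))) * ih

/-- The infinitesimal injectivity of iteration, modulo scaling: otherwise `wedge P G / jac P` would
be an invariant meromorphic vector field of the `n`-th iterate. -/
theorem wedge_eq_zero_of_wedge_iterVar_eq_zero (hd : 2 ≤ d) (hP : ∀ j, (P j).IsHomogeneous d)
    (h : NoCommonZero P) (hG : ∀ j, (G j).IsHomogeneous d) {n : ℕ} (hn : 1 ≤ n)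
    (hW : wedge (iterForms P n) (iterVar P G n) = 0) : wedge P G = 0 := by
  by_contra hω
  have h1 := wedge_iterVar_succ (G := G) hP n
  have h2 := wedge_iterVar_succ' (G := G) hP n
  rw [hW, mul_zero, add_zero] at h1
  rw [hW, map_zero, mul_zero, zero_add] at h2
  have hd0 : (C (d : ℂ) : MvPolynomial (Fin 2) ℂ) ≠ 0 := by
    simpa using (by omega : d ≠ 0)
  have h3 := mul_left_cancel₀ hd0 h1
  rw [h3] at h2
  have hωd : (wedge P G).IsHomogeneous (d - 1 + (d - 1) + 2) := by
    have := ((hP 0).mul (hG 1)).sub ((hP 1).mul (hG 0))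
    rwa [show d + d = d - 1 + (d - 1) + 2 by omega] at this
  refine no_invariant_quotient (D := d ^ n) (le_trans hd (Nat.le_self_pow (by omega) d))
    (iterForms_isHomogeneous hP n) (h.iterForms n) hωd (jac_isHomogeneous (hP 0) (hP 1)) hω
    (h.jac_ne_zero (by omega) hP) ?_
  have h4 := jac_iterForms_succ (P := P) n
  rw [jac_iterForms_succ'] at h4
  push_cast
  rw [map_pow]
  linear_combination jac (P 0) (P 1) * h2 + wedge P G * h4

/-- `wedge P` detects tangent vectors modulo multiples of `P`. -/
theorem eq_C_mul_of_wedge_eq_zero (hd : 1 ≤ d) (hP : ∀ j, (P j).IsHomogeneous d)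
    (h : NoCommonZero P) (hG : ∀ j, (G j).IsHomogeneous d) (hw : wedge P G = 0) :
    ∃ c : ℂ, ∀ j, G j = C c * P j := by
  have hw : P 0 * G 1 - P 1 * G 0 = 0 := hw
  have hdvd : P 0 ∣ G 0 := by
    refine dvd_of_dvd_mul_of_no_common_zero (B := P 1) (hP 0) (hG 0) ?_
      ⟨G 1, by linear_combination -hw⟩
    intro z hz h0 h1
    exact eval_ne_zero_of_noCommonZero h hz ⟨h0, h1⟩
  obtain ⟨Q, hQ, hGQ⟩ := exists_homogeneous_cofactor (hG 0) (hP 0) le_rfl hdvd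
  rw [Nat.sub_self] at hQ
  obtain ⟨c, rfl⟩ := eq_C_of_isHomogeneous_zero hQ
  refine ⟨c, fun j => ?_⟩
  fin_cases j
  · exact hGQ.trans (mul_comm _ _)
  · apply mul_left_cancel₀ (h.ne_zero hd hP 0)
    change P 0 * G 1 = P 0 * (C c * P 1)
    linear_combination hw + P 1 * hGQ

end

/-! ### Differentiating with respect to the coefficients -/

theorem hasDerivAt_eval (A : MvPolynomial (Fin 2) ℂ) {ζ : ℂ → Fin 2 → ℂ} {ζ' : Fin 2 → ℂ} {t : ℂ}
    (hζ : ∀ j, HasDerivAt (fun s => ζ s j) (ζ' j) t) :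
    HasDerivAt (fun s => eval (ζ s) A)
      (eval (ζ t) (pderiv 0 A) * ζ' 0 + eval (ζ t) (pderiv 1 A) * ζ' 1) t := by
  induction A using MvPolynomial.induction_on with
  | C c => simpa using hasDerivAt_const t c
  | add p q hp hq =>
    simp only [map_add]
    exact (hp.add hq).congr_deriv (by ring)
  | mul_X p j hp =>
    simp only [map_mul, eval_X]
    refine (hp.mul (hζ j)).congr_deriv ?_
    fin_cases j <;> simp [pderiv_X] <;> ring

theorem forms_add (d : ℕ) (v w : Fin (2 * d + 1 + 1) → ℂ) (j : Fin 2) :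
    forms d (v + w) j = forms d v j + forms d w j := by
  fin_cases j <;> simp [forms, add_mul, Finset.sum_add_distrib]

/-- `iterVar` is the derivative of the iterate along the line `v + t w`. -/
theorem hasDerivAt_eval_iterForms (d : ℕ) (v w : Fin (2 * d + 1 + 1) → ℂ) (z : Fin 2 → ℂ) (n : ℕ)
    (j : Fin 2) :
    HasDerivAt (fun t : ℂ => eval z (iterForms (forms d (v + t • w)) n j))
      (eval z (iterVar (forms d v) (forms d w) n j)) 0 := by
  induction n generalizing j with
  | zero => simpa [iterForms, iterVar] using hasDerivAt_const (0 : ℂ) (z j)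
  | succ n ih =>
    simp only [iterForms_succ', iterVar, eval_bind₁', forms_add, forms_smul, map_add, map_mul,
      eval_C]
    have h1 := hasDerivAt_eval (forms d v j) ih
    have h2 := (hasDerivAt_id (0 : ℂ)).mul (hasDerivAt_eval (forms d w j) ih)
    simp only [zero_smul, add_zero, id] at h1 h2
    refine (h1.add h2).congr_deriv ?_
    simp
    ring

/-- The value at `z` of the `j`-th form, as a linear function of the coefficient vector. -/
def evalForms (d : ℕ) (z : Fin 2 → ℂ) (j : Fin 2) : (Fin (2 * d + 1 + 1) → ℂ) →ₗ[ℂ] ℂ where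
  toFun v := eval z (forms d v j)
  map_add' v w := by rw [forms_add, map_add]
  map_smul' c v := by simp [forms_smul]

/-- The coefficient vector of the `n`-th iterate, as a function of the coefficient vector. -/
def iterCoeffs (d n : ℕ) (v : Fin (2 * d + 1 + 1) → ℂ) : Fin (2 * d ^ n + 1 + 1) → ℂ :=
  coeffs (d ^ n) (iterForms (forms d v) n)

theorem contDiff_coeff_mul {V : Type*} [NormedAddCommGroup V] [NormedSpace ℂ V]
    {A B : V → MvPolynomial (Fin 2) ℂ}
    (hA : ∀ m, ContDiff ℂ ω fun v => coeff m (A v)) (hB : ∀ m, ContDiff ℂ ω fun v => coeff m (B v))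
    (m : Fin 2 →₀ ℕ) : ContDiff ℂ ω fun v => coeff m (A v * B v) := by
  simp only [coeff_mul]
  exact ContDiff.sum fun x _ => (hA x.1).mul (hB x.2)

theorem contDiff_coeff_pow {V : Type*} [NormedAddCommGroup V] [NormedSpace ℂ V]
    {A : V → MvPolynomial (Fin 2) ℂ} (hA : ∀ m, ContDiff ℂ ω fun v => coeff m (A v)) (k : ℕ)
    (m : Fin 2 →₀ ℕ) : ContDiff ℂ ω fun v => coeff m (A v ^ k) := by
  induction k generalizing m with
  | zero => simpa using contDiff_const
  | succ k ih => simpa only [pow_succ] using contDiff_coeff_mul ih hA m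

theorem contDiff_coeff_iterForms (d n : ℕ) (j : Fin 2) (m : Fin 2 →₀ ℕ) :
    ContDiff ℂ ω fun v : Fin (2 * d + 1 + 1) → ℂ => coeff m (iterForms (forms d v) n j) := by
  induction n generalizing j m with
  | zero => exact contDiff_const
  | succ n ih =>
    simp only [iterForms_succ']
    fin_cases j
    all_goals
      simp only [forms, Fin.zero_eta, Fin.mk_one, Matrix.cons_val_zero, Matrix.cons_val_one,
        Matrix.cons_val_fin_one, map_sum, map_mul, map_pow, bind₁_C_right, bind₁_X_right, coeff_sum,
        coeff_C_mul]
      refine ContDiff.sum fun i _ => (contDiff_apply ℂ ℂ _).mul ?_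
      exact contDiff_coeff_mul (contDiff_coeff_pow (ih 0) _) (contDiff_coeff_pow (ih 1) _) m

theorem contDiff_iterCoeffs (d n : ℕ) : ContDiff ℂ ω (iterCoeffs d n) := by
  refine contDiff_pi.2 fun k => ?_
  simp only [iterCoeffs, coeffs]
  split_ifs
  · exact contDiff_coeff_iterForms d n 0 _
  · exact contDiff_coeff_iterForms d n 1 _

theorem forms_iterCoeffs (d n : ℕ) (v : Fin (2 * d + 1 + 1) → ℂ) :
    forms (d ^ n) (iterCoeffs d n v) = iterForms (forms d v) n :=
  forms_coeffs (iterForms_isHomogeneous (forms_isHomogeneous d v) n)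

theorem coeffs_forms (d : ℕ) (v : Fin (2 * d + 1 + 1) → ℂ) : coeffs d (forms d v) = v := by
  have key : ∀ (c : Fin (d + 1) → ℂ) (k : Fin (d + 1)), coeff (expo d k) (∑ i : Fin (d + 1),
      C (c i) * (X 0 ^ (i : ℕ) * X 1 ^ (d - i)) : MvPolynomial (Fin 2) ℂ) = c k := by
    intro c k
    have hmon : ∀ i : ℕ, (X 0 ^ i * X 1 ^ (d - i) : MvPolynomial (Fin 2) ℂ) =
        monomial (expo d i) 1 := fun i => by
      rw [expo, X_pow_eq_monomial, X_pow_eq_monomial, monomial_mul, one_mul]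
    simp only [hmon, coeff_sum, coeff_C_mul, coeff_monomial]
    rw [Finset.sum_eq_single k]
    · simp
    · intro b _ hb
      rw [if_neg, mul_zero]
      intro h
      have := DFunLike.congr_fun h 0
      simp [expo] at this
      exact hb (Fin.ext this)
    · simp
  funext k
  simp only [coeffs]
  split_ifs with hk
  · exact key (fun i => v ⟨i, by omega⟩) ⟨k, hk⟩
  · have := key (fun i => v ⟨d + 1 + i, by omega⟩) ⟨k - (d + 1), by omega⟩
    refine this.trans (congrArg v (Fin.ext ?_))
    simp only
    omega

theorem forms_injective (d : ℕ) : Function.Injective (forms d) :=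
  Function.LeftInverse.injective (coeffs_forms d)

/-- If the derivative of the coefficient vector of the iterate in the direction `w` is proportional
to that vector, then `w` is proportional to `v`. -/
theorem exists_eq_smul_of_fderiv_iterCoeffs {d n : ℕ} (hd : 2 ≤ d) (hn : 1 ≤ n)
    {v w : Fin (2 * d + 1 + 1) → ℂ} (hv : NoCommonZero (forms d v)) {c : ℂ}
    (h : fderiv ℂ (iterCoeffs d n) v w = c • iterCoeffs d n v) : ∃ c' : ℂ, w = c' • v := by
  have hline : HasDerivAt (fun t : ℂ => v + t • w) w 0 := by
    simpa using ((hasDerivAt_id (0 : ℂ)).smul_const w).const_add v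
  have hdiff : HasFDerivAt (iterCoeffs d n) (fderiv ℂ (iterCoeffs d n) v) (v + (0 : ℂ) • w) := by
    simpa using ((contDiff_iterCoeffs d n).differentiable (by simp) v).hasFDerivAt
  have hcurve := hdiff.comp_hasDerivAt (0 : ℂ) hline
  rw [h] at hcurve
  have hval : ∀ z j, eval z (iterVar (forms d v) (forms d w) n j) =
      c * eval z (iterForms (forms d v) n j) := by
    intro z j
    have h1 := (LinearMap.toContinuousLinearMap (evalForms (d ^ n) z j)).hasFDerivAt.comp_hasDerivAt
      (0 : ℂ) hcurve
    have h2 := hasDerivAt_eval_iterForms d v w z n j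
    have h3 := h1.unique (h2.congr_of_eventuallyEq (.of_forall fun t => by
      simp [evalForms, forms_iterCoeffs]))
    rw [← h3]
    simp [evalForms, forms_iterCoeffs]
  have hW : wedge (iterForms (forms d v) n) (iterVar (forms d v) (forms d w) n) = 0 := by
    apply MvPolynomial.funext
    intro z
    simp only [wedge, map_sub, map_mul, hval, map_zero]
    ring
  obtain ⟨c', hc'⟩ := eq_C_mul_of_wedge_eq_zero (by omega) (forms_isHomogeneous d v) hv
    (forms_isHomogeneous d w) (wedge_eq_zero_of_wedge_iterVar_eq_zero hd (forms_isHomogeneous d v)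
      hv (forms_isHomogeneous d w) hn hW)
  refine ⟨c', forms_injective d (funext fun j => ?_)⟩
  rw [hc', forms_smul]

end RatMap

/-! ### Immersions between finite-dimensional manifolds -/

section

open Set Filter Topology

variable {𝕜 : Type*} [RCLike 𝕜] {E : Type*} [NormedAddCommGroup E] [NormedSpace 𝕜 E]

/-- The inverse function theorem, giving an element of the groupoid of local diffeomorphisms. -/
theorem ContDiffAt.exists_mem_contDiffGroupoid [CompleteSpace E] {n : WithTop ℕ∞} (hn : 1 ≤ n)
    (hn' : n ≠ ∞) {Θ : E → E} {b : E} (hΘ : ContDiffAt 𝕜 n Θ b) {L : E ≃L[𝕜] E}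
    (hL : HasFDerivAt Θ (L : E →L[𝕜] E) b) :
    ∃ T : OpenPartialHomeomorph E E, T ∈ contDiffGroupoid n 𝓘(𝕜, E) ∧ b ∈ T.source ∧ ⇑T = Θ := by
  have hn0 : n ≠ 0 := by rintro rfl; simp at hn
  have hev : ∀ᶠ y in 𝓝 b, ContDiffAt 𝕜 n Θ y ∧
      fderiv 𝕜 Θ y ∈ range ((↑) : (E ≃L[𝕜] E) → E →L[𝕜] E) := by
    refine (hΘ.eventually hn').and ?_
    have hc : ContinuousAt (fderiv 𝕜 Θ) b :=
      (hΘ.fderiv_right (m := 0) (by simpa using hn)).continuousAt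
    apply hc.eventually_mem
    rw [hL.fderiv]
    exact ContinuousLinearEquiv.nhds L
  obtain ⟨U, hU, hUo, hbU⟩ := eventually_nhds_iff.1 hev
  set T0 := hΘ.toOpenPartialHomeomorph Θ hL hn0
  have hT0 : ⇑T0 = Θ := rfl
  refine ⟨T0.restrOpen U hUo, ?_, ⟨hΘ.mem_toOpenPartialHomeomorph_source hL hn0, hbU⟩, rfl⟩
  rw [contDiffGroupoid, mem_groupoid_of_pregroupoid]
  constructor
  · have : ContDiffOn 𝕜 n Θ (T0.source ∩ U) := fun y hy => (hU y hy.2).1.contDiffWithinAt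
    simpa [contDiffPregroupoid, hT0] using this
  · have : ContDiffOn 𝕜 n T0.symm (T0.restrOpen U hUo).target := by
      intro y hy
      have hy' := (T0.restrOpen U hUo).map_target hy
      obtain ⟨h1, L', hL'⟩ := hU _ hy'.2
      have h2 := (T0.restrOpen U hUo).symm.map_source hy
      refine (T0.contDiffAt_symm (f₀' := L') ?_ ?_ h1).contDiffWithinAt
      · exact hy.1
      · rw [hL']
        exact (h1.differentiableAt hn0).hasFDerivAt
    simpa [contDiffPregroupoid] using this

theorem StructureGroupoid.trans_mem_maximalAtlas {H M : Type*} [TopologicalSpace H]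
    [TopologicalSpace M] [ChartedSpace H M] {G : StructureGroupoid H} [HasGroupoid M G]
    {e : OpenPartialHomeomorph M H} (he : e ∈ G.maximalAtlas M) {T : OpenPartialHomeomorph H H}
    (hT : T ∈ G) : e ≫ₕ T ∈ G.maximalAtlas M := by
  intro e' he'
  have he'' := G.subset_maximalAtlas he'
  constructor
  · rw [OpenPartialHomeomorph.trans_symm_eq_symm_trans_symm, OpenPartialHomeomorph.trans_assoc]
    exact G.trans (G.symm hT) (G.compatible_of_mem_maximalAtlas he he'')
  · rw [← OpenPartialHomeomorph.trans_assoc]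
    exact G.trans (G.compatible_of_mem_maximalAtlas he'' he) hT

variable {E' F : Type*} [NormedAddCommGroup E'] [NormedSpace 𝕜 E'] [NormedAddCommGroup F]
  [NormedSpace 𝕜 F] {M N : Type*} [TopologicalSpace M] [ChartedSpace E M] [TopologicalSpace N]
  [ChartedSpace E' N]

/-- An injective linear map between finite-dimensional spaces extends to an isomorphism from the
product with any space of complementary dimension. -/
theorem LinearMap.exists_continuousLinearEquiv_prod [FiniteDimensional 𝕜 E]
    [FiniteDimensional 𝕜 E'] [FiniteDimensional 𝕜 F] {L : E →ₗ[𝕜] E'}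
    (hL : Function.Injective L)
    (hF : Module.finrank 𝕜 E + Module.finrank 𝕜 F = Module.finrank 𝕜 E') :
    ∃ e : (E × F) ≃L[𝕜] E', ∀ u, e (u, 0) = L u := by
  obtain ⟨K, hK⟩ := L.range.exists_isCompl
  have h1 := LinearMap.finrank_range_of_inj hL
  have h2 := Submodule.finrank_add_eq_of_isCompl hK
  have h3 : Module.finrank 𝕜 F = Module.finrank 𝕜 K := by omega
  let φ := LinearEquiv.ofFinrankEq F K h3
  let e := ((LinearEquiv.ofInjective L hL).prodCongr φ).trans (Submodule.prodEquivOfIsCompl _ K hK)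
  refine ⟨e.toContinuousLinearEquiv, fun u => ?_⟩
  simp [e]

theorem MDifferentiableAt.mfderiv_eq_fderiv_chart {f : M → N} {x : M}
    (hf : MDifferentiableAt 𝓘(𝕜, E) 𝓘(𝕜, E') f x) :
    mfderiv 𝓘(𝕜, E) 𝓘(𝕜, E') f x =
      fderiv 𝕜 (chartAt E' (f x) ∘ f ∘ (chartAt E x).symm) (chartAt E x x) := by
  have h := hf.mfderiv
  have hr : range (𝓘(𝕜, E) : E → E) = univ := range_id
  rw [hr] at h
  exact h.trans (congrFun fderivWithin_univ _)

/-- A `C^n` map between finite-dimensional manifolds with injective differential at `x` is an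
immersion at `x`. If `g` is the map read in charts, with differential `L` at the base point, then
`(u, y) ↦ g u + y`, for `y` in a complement of the range of `L`, is a local diffeomorphism;
its inverse straightens the image of `g`. -/
theorem ContMDiffAt.isImmersionAtOfComplement_of_injective_mfderiv [FiniteDimensional 𝕜 E]
    [FiniteDimensional 𝕜 E'] [FiniteDimensional 𝕜 F] {n : WithTop ℕ∞} (hn : 1 ≤ n) (hn' : n ≠ ∞)
    [IsManifold 𝓘(𝕜, E) n M] [IsManifold 𝓘(𝕜, E') n N]
    (hF : Module.finrank 𝕜 E + Module.finrank 𝕜 F = Module.finrank 𝕜 E') {f : M → N} {x : M}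
    (hf : ContMDiffAt 𝓘(𝕜, E) 𝓘(𝕜, E') n f x)
    (hinj : Function.Injective (mfderiv 𝓘(𝕜, E) 𝓘(𝕜, E') f x)) :
    Manifold.IsImmersionAtOfComplement F 𝓘(𝕜, E) 𝓘(𝕜, E') n f x := by
  have hn0 : n ≠ 0 := by rintro rfl; simp at hn
  have : CompleteSpace E' := FiniteDimensional.complete 𝕜 E'
  set g : E → E' := chartAt E' (f x) ∘ f ∘ (chartAt E x).symm with hg
  set a : E := chartAt E x x with ha
  have hgc : ContDiffAt 𝕜 n g a := by
    have := (contMDiffAt_iff.1 hf).2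
    simpa [hg, ha, contDiffWithinAt_univ] using this
  have hgd : HasFDerivAt g (fderiv 𝕜 g a) a := (hgc.differentiableAt hn0).hasFDerivAt
  have hinj' : Function.Injective (fderiv 𝕜 g a) := by
    rwa [(hf.mdifferentiableAt hn0).mfderiv_eq_fderiv_chart] at hinj
  obtain ⟨e, he⟩ := LinearMap.exists_continuousLinearEquiv_prod (F := F)
    (L := (fderiv 𝕜 g a : E →ₗ[𝕜] E')) hinj' hF
  -- The local diffeomorphism `(u, y) ↦ g u + y`, read on `E'` through `e`: its derivative at the
  -- base point is the identity.
  set Θ : E' → E' := fun y => g (e.symm y).1 + e (0, (e.symm y).2) with hΘ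
  set b : E' := e (a, 0) with hb
  have hfst : (e.symm b).1 = a := by simp [hb]
  have hΘc : ContDiffAt 𝕜 n Θ b := by
    have h1 : ContDiffAt 𝕜 n (fun y => (e.symm y).1) b :=
      contDiffAt_fst.comp b e.symm.contDiff.contDiffAt
    have h2 : ContDiffAt 𝕜 n (fun y => e (0, (e.symm y).2)) b :=
      e.contDiff.contDiffAt.comp b (contDiffAt_const.prodMk
        (contDiffAt_snd.comp b e.symm.contDiff.contDiffAt))
    exact (ContDiffAt.comp b (by rw [hfst]; exact hgc) h1).add h2
  have hΘd : HasFDerivAt Θ ((ContinuousLinearEquiv.refl 𝕜 E' : E' ≃L[𝕜] E') : E' →L[𝕜] E') b := by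
    have h1 : HasFDerivAt (fun y => (e.symm y).1)
        ((ContinuousLinearMap.fst 𝕜 E F).comp (e.symm : E' →L[𝕜] E × F)) b :=
      ((ContinuousLinearMap.fst 𝕜 E F).comp (e.symm : E' →L[𝕜] E × F)).hasFDerivAt
    have h2 : HasFDerivAt (fun y => e (0, (e.symm y).2))
        ((e : E × F →L[𝕜] E').comp ((ContinuousLinearMap.inr 𝕜 E F).comp
          ((ContinuousLinearMap.snd 𝕜 E F).comp (e.symm : E' →L[𝕜] E × F)))) b :=
      ((e : E × F →L[𝕜] E').comp ((ContinuousLinearMap.inr 𝕜 E F).comp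
          ((ContinuousLinearMap.snd 𝕜 E F).comp (e.symm : E' →L[𝕜] E × F)))).hasFDerivAt
    have h3 := (HasFDerivAt.comp b (by rw [hfst]; exact hgd) h1).add h2
    refine h3.congr_fderiv ?_
    ext y
    have h4 := he (e.symm y).1
    simp only [ContinuousLinearMap.coe_coe] at h4
    simp only [add_apply, ContinuousLinearMap.comp_apply,
      ContinuousLinearMap.coe_fst', ContinuousLinearMap.coe_snd', ContinuousLinearEquiv.coe_coe,
      ContinuousLinearMap.inr_apply, ContinuousLinearEquiv.refl_apply]
    rw [← h4, ← map_add]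
    simp
  obtain ⟨T, hTG, hbT, hT⟩ := hΘc.exists_mem_contDiffGroupoid hn hn' hΘd
  have hTu : ∀ u, T (e (u, 0)) = g u := fun u => by simp [hT, hΘ]
  have hga : g a = chartAt E' (f x) (f x) := by simp [hg, ha]
  set U : Set E := (fun u => e (u, (0 : F))) ⁻¹' T.source with hU
  have hUo : IsOpen U := T.open_source.preimage (by fun_prop)
  set s : Set M := (chartAt E x).source ∩ chartAt E x ⁻¹' U with hs
  have hso : IsOpen s := (chartAt E x).isOpen_inter_preimage hUo
  refine Manifold.IsImmersionAtOfComplement.mk_of_continuousAt hf.continuousAt e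
    ((chartAt E x).restr s) (chartAt E' (f x) ≫ₕ T.symm) ?_ ?_
    (restr_mem_maximalAtlas _ (IsManifold.chart_mem_maximalAtlas x) hso)
    (StructureGroupoid.trans_mem_maximalAtlas (IsManifold.chart_mem_maximalAtlas (f x))
      ((contDiffGroupoid n 𝓘(𝕜, E')).symm hTG)) ?_
  · rw [OpenPartialHomeomorph.restr_source, hso.interior_eq]
    exact ⟨mem_chart_source E x, mem_chart_source E x, hbT⟩
  · rw [OpenPartialHomeomorph.trans_source]
    refine ⟨mem_chart_source E' _, ?_⟩
    change chartAt E' (f x) (f x) ∈ T.target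
    rw [← hga, ← hTu]
    exact T.map_source hbT
  · intro u hu
    have hu' : e (u, 0) ∈ T.source := by
      have h1 := ((chartAt E x).restr s).map_target (x := u) (by simpa using hu)
      rw [OpenPartialHomeomorph.restr_source, hso.interior_eq] at h1
      have h2 : u ∈ (chartAt E x).target := by
        have : u ∈ ((chartAt E x).restr s).target := by simpa using hu
        exact this.1
      have h3 := h1.2.2
      change e (chartAt E x ((chartAt E x).symm u), 0) ∈ T.source at h3
      rwa [(chartAt E x).right_inv h2] at h3
    change T.symm (g u) = e (u, 0)
    rw [← hTu, T.left_inv hu']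

end

namespace RatMap

open MvPolynomial Topology Filter

/-! ### The iteration map in affine charts -/

theorem exists_iterForms_smul (d n : ℕ) {c : ℂ} (hc : c ≠ 0) (v : Fin (2 * d + 1 + 1) → ℂ) :
    ∃ c' : ℂ, c' ≠ 0 ∧ ∀ j, iterForms (forms d (c • v)) n j = C c' * iterForms (forms d v) n j := by
  induction n with
  | zero => exact ⟨1, one_ne_zero, by simp [iterForms]⟩
  | succ n ih =>
    obtain ⟨c', hc', h⟩ := ih
    refine ⟨c * c' ^ d, mul_ne_zero hc (pow_ne_zero _ hc'), fun j => MvPolynomial.funext fun z => ?_⟩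
    have : (fun j => eval z (iterForms (forms d (c • v)) n j)) =
        c' • fun j => eval z (iterForms (forms d v) n j) := by
      ext j; simp [h]
    simp only [iterForms_succ', map_mul, eval_C, eval_bind₁', this, forms_smul,
      eval_smul_of_isHomogeneous (forms_isHomogeneous d v j)]
    ring

theorem exists_iterCoeffs_smul (d n : ℕ) {c : ℂ} (hc : c ≠ 0) (v : Fin (2 * d + 1 + 1) → ℂ) :
    ∃ c' : ℂ, c' ≠ 0 ∧ iterCoeffs d n (c • v) = c' • iterCoeffs d n v := by
  obtain ⟨c', hc', h⟩ := exists_iterForms_smul d n hc v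
  refine ⟨c', hc', forms_injective _ (funext fun j => ?_)⟩
  rw [forms_iterCoeffs, h, forms_smul, forms_iterCoeffs]

theorem iterCoeffs_ne_zero {d : ℕ} {v : Fin (2 * d + 1 + 1) → ℂ} (hv : NoCommonZero (forms d v))
    (n : ℕ) : iterCoeffs d n v ≠ 0 :=
  coeffs_ne_zero (iterForms_isHomogeneous (forms_isHomogeneous d _) n) (hv.iterForms n)

/-- The iteration map may be computed with any representative. -/
theorem coe_iterationMap_of_eq_mk {d : ℕ} (n : ℕ) {f : RatSpace d} {v : Fin (2 * d + 1 + 1) → ℂ}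
    (hv : v ≠ 0) (hv' : NoCommonZero (forms d v)) (h : f.1 = Projectivization.mk ℂ v hv) :
    (iterationMap d n f).1 = Projectivization.mk ℂ (iterCoeffs d n v) (iterCoeffs_ne_zero hv' n) := by
  obtain ⟨c, hc, hcv⟩ := ComplexProj.exists_smul_rep v hv
  obtain ⟨c', hc', hcc'⟩ := exists_iterCoeffs_smul d n hc v
  change Projectivization.mk ℂ (iterCoeffs d n f.1.rep) _ = _
  exact (Projectivization.mk_eq_mk_iff' ℂ _ _ _ _).2 ⟨c', by rw [h, hcv, hcc']⟩

theorem continuous_iterationMap (d n : ℕ) : Continuous (iterationMap d n) := by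
  let π : {v : Fin (2 * d + 1 + 1) → ℂ // v ≠ 0} → ℙ ℂ (Fin (2 * d + 1 + 1) → ℂ) :=
    Projectivization.mk' ℂ
  let s : Set (ℙ ℂ (Fin (2 * d + 1 + 1) → ℂ)) := RatSpace d
  have hq : IsQuotientMap (s.restrictPreimage π) :=
    ComplexProj.isQuotientMap_mk'.restrictPreimage_isOpen (RatSpace d).isOpen
  have hnc : ∀ v : π ⁻¹' s, NoCommonZero (forms d v.1.1) := fun v =>
    (mk_mem_ratSpace_iff v.1.1 v.1.2).1 v.2
  have hcont : Continuous fun v : π ⁻¹' s =>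
      (⟨iterCoeffs d n v.1.1, iterCoeffs_ne_zero (hnc v) n⟩ :
        {v : Fin (2 * d ^ n + 1 + 1) → ℂ // v ≠ 0}) :=
    ((contDiff_iterCoeffs d n).continuous.comp
      (continuous_subtype_val.comp continuous_subtype_val)).subtype_mk _
  refine hq.continuous_iff.2 (continuous_induced_rng.2 ?_)
  refine (ComplexProj.isQuotientMap_mk'.continuous.comp hcont).congr fun v => ?_
  exact (coe_iterationMap_of_eq_mk n (f := s.restrictPreimage π v) v.1.2 (hnc v) rfl).symm

/-- The linear part of the affine map `w ↦ i.insertNth 1 w`. -/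
def insertZero {m : ℕ} (i : Fin (m + 1)) : (Fin m → ℂ) →ₗ[ℂ] (Fin (m + 1) → ℂ) where
  toFun w := i.insertNth (0 : ℂ) w
  map_add' u w := by
    ext k
    rcases Fin.eq_self_or_eq_succAbove i k with rfl | ⟨j, rfl⟩ <;> simp
  map_smul' c w := by
    ext k
    rcases Fin.eq_self_or_eq_succAbove i k with rfl | ⟨j, rfl⟩ <;> simp

theorem insertNth_one_eq {m : ℕ} (i : Fin (m + 1)) (w : Fin m → ℂ) :
    (i.insertNth (1 : ℂ) w : Fin (m + 1) → ℂ) =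
      LinearMap.toContinuousLinearMap (insertZero i) w + Pi.single i 1 := by
  ext k
  rcases Fin.eq_self_or_eq_succAbove i k with rfl | ⟨j, rfl⟩ <;> simp [insertZero]

theorem hasFDerivAt_insertNth_one {m : ℕ} (i : Fin (m + 1)) (w : Fin m → ℂ) :
    HasFDerivAt (fun w : Fin m → ℂ => (i.insertNth (1 : ℂ) w : Fin (m + 1) → ℂ))
      (LinearMap.toContinuousLinearMap (insertZero i)) w := by
  simp only [insertNth_one_eq]
  exact (ContinuousLinearMap.hasFDerivAt _).add_const _

theorem contDiff_insertNth_one {m : ℕ} (i : Fin (m + 1)) :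
    ContDiff ℂ ω (fun w : Fin m → ℂ => (i.insertNth (1 : ℂ) w : Fin (m + 1) → ℂ)) := by
  simp only [insertNth_one_eq]
  exact (ContinuousLinearMap.contDiff _).add contDiff_const

/-- The iteration map read in the `i`-th affine chart of the source and the `k`-th affine chart of
the target. -/
def chartIter (d n : ℕ) (i : Fin (2 * d + 1 + 1)) (k : Fin (2 * d ^ n + 1 + 1))
    (w : Fin (2 * d + 1) → ℂ) : Fin (2 * d ^ n + 1) → ℂ :=
  fun j => iterCoeffs d n (i.insertNth (1 : ℂ) w) (k.succAbove j) /
    iterCoeffs d n (i.insertNth (1 : ℂ) w) k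

section
variable {d n : ℕ} {i : Fin (2 * d + 1 + 1)} {k : Fin (2 * d ^ n + 1 + 1)} {w : Fin (2 * d + 1) → ℂ}

theorem contDiff_iterCoeffs_insertNth (l : Fin (2 * d ^ n + 1 + 1)) :
    ContDiff ℂ ω fun w : Fin (2 * d + 1) → ℂ => iterCoeffs d n (i.insertNth (1 : ℂ) w) l :=
  (contDiff_apply ℂ ℂ l).comp ((contDiff_iterCoeffs d n).comp (contDiff_insertNth_one i))

theorem contDiffAt_chartIter (hk : iterCoeffs d n (i.insertNth (1 : ℂ) w) k ≠ 0) :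
    ContDiffAt ℂ ω (chartIter d n i k) w :=
  contDiffAt_pi.2 fun _ => (contDiff_iterCoeffs_insertNth _).contDiffAt.div
    (contDiff_iterCoeffs_insertNth _).contDiffAt hk

/-- An affine chart direction `insertZero i u` proportional to the representative
`i.insertNth 1 w` is zero, as its `i`-th coordinate vanishes. -/
theorem injective_fderiv_chartIter (hd : 2 ≤ d) (hn : 1 ≤ n)
    (hw : NoCommonZero (forms d (i.insertNth (1 : ℂ) w)))
    (hk : iterCoeffs d n (i.insertNth (1 : ℂ) w) k ≠ 0) :
    Function.Injective (fderiv ℂ (chartIter d n i k) w) := by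
  rw [injective_iff_map_eq_zero]
  intro u hu
  set S : (Fin (2 * d + 1) → ℂ) → Fin (2 * d + 1 + 1) → ℂ := fun w => i.insertNth (1 : ℂ) w with hS
  set Φ' := fderiv ℂ (iterCoeffs d n) (S w) with hΦ'
  have hN : HasFDerivAt (fun w => iterCoeffs d n (S w))
      (Φ'.comp (LinearMap.toContinuousLinearMap (insertZero i))) w :=
    ((contDiff_iterCoeffs d n).differentiable (by simp) _).hasFDerivAt.comp w
      (hasFDerivAt_insertNth_one i w)
  have hk' : iterCoeffs d n (S w) k ≠ 0 := hk
  have hNl := fun l => hasFDerivAt_pi'.1 hN l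
  have hq := fun j => hasFDerivAt_pi'.1
    ((contDiffAt_chartIter hk).differentiableAt (by simp)).hasFDerivAt j
  -- Along `u` the coefficient vector moves proportionally to itself.
  set c := Φ' (insertZero i u) k / iterCoeffs d n (S w) k with hc
  have hprop : Φ' (insertZero i u) = c • iterCoeffs d n (S w) := by
    ext l
    rcases Fin.eq_self_or_eq_succAbove k l with rfl | ⟨j, rfl⟩
    · simp [hc, div_mul_cancel₀ _ hk']
    · have hev : (fun w => iterCoeffs d n (S w) (k.succAbove j)) =ᶠ[𝓝 w]
          fun w => chartIter d n i k w j * iterCoeffs d n (S w) k := by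
        have hcont : ContinuousAt (fun w => iterCoeffs d n (S w) k) w :=
          (contDiff_iterCoeffs_insertNth k).continuous.continuousAt
        filter_upwards [hcont.eventually_ne hk] with w' hw'
        exact (div_mul_cancel₀ _ hw').symm
      have h1 := (hNl (k.succAbove j)).unique (((hq j).mul (hNl k)).congr_of_eventuallyEq hev)
      have h2 := DFunLike.congr_fun h1 u
      simp [hu] at h2
      simp only [Pi.smul_apply, smul_eq_mul, hc]
      rw [h2]
      change iterCoeffs d n (S w) (k.succAbove j) / iterCoeffs d n (S w) k * _ = _
      ring
  obtain ⟨c', hc'⟩ := exists_eq_smul_of_fderiv_iterCoeffs hd hn hw hprop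
  have h0 : c' = 0 := by
    have := congrFun hc' i
    simpa [insertZero, hS] using this.symm
  rw [h0, zero_smul] at hc'
  ext j
  have := congrFun hc' (i.succAbove j)
  simpa [insertZero] using this

end

/-- Near the base point, the iteration map read in the preferred charts is `chartIter`, and the
point satisfies the hypotheses of `contDiffAt_chartIter` and `injective_fderiv_chartIter`. -/
theorem iterationMap_chart_eventuallyEq (d n : ℕ) (f : RatSpace d) :
    ∃ (i : Fin (2 * d + 1 + 1)) (k : Fin (2 * d ^ n + 1 + 1)),
      NoCommonZero (forms d (i.insertNth (1 : ℂ) (chartAt (Fin (2 * d + 1) → ℂ) f f))) ∧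
      iterCoeffs d n (i.insertNth (1 : ℂ) (chartAt (Fin (2 * d + 1) → ℂ) f f)) k ≠ 0 ∧
      chartAt (Fin (2 * d ^ n + 1) → ℂ) (iterationMap d n f) ∘ iterationMap d n ∘
        (chartAt (Fin (2 * d + 1) → ℂ) f).symm =ᶠ[𝓝 (chartAt (Fin (2 * d + 1) → ℂ) f f)]
          chartIter d n i k := by
  obtain ⟨i, hi⟩ : ∃ i, chartAt (Fin (2 * d + 1) → ℂ) f.1 = ComplexProj.chart i := ⟨_, rfl⟩
  obtain ⟨k, hk⟩ : ∃ k, chartAt (Fin (2 * d ^ n + 1) → ℂ) (iterationMap d n f).1 =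
    ComplexProj.chart k := ⟨_, rfl⟩
  have hkval : ∀ g, chartAt (Fin (2 * d ^ n + 1) → ℂ) (iterationMap d n f) g =
      ComplexProj.chart k g.1 := fun g => by rw [← hk]; rfl
  have hsymm := TopologicalSpace.Opens.chartAt_subtype_val_symm_eventuallyEq
    (H := Fin (2 * d + 1) → ℂ) (RatSpace d) (x := f)
  set w := chartAt (Fin (2 * d + 1) → ℂ) f f with hw
  change _ =ᶠ[𝓝 w] _ at hsymm
  rw [hi] at hsymm
  -- The representative of a nearby point provided by the chart.
  have hrep : ∀ u, (ComplexProj.chart i).symm u = ((chartAt (Fin (2 * d + 1) → ℂ) f).symm u).1 →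
      NoCommonZero (forms d (i.insertNth (1 : ℂ) u)) := fun u hu => by
    rw [← mk_mem_ratSpace_iff _ (ComplexProj.insertNth_one_ne_zero i u)]
    change (ComplexProj.chart i).symm u ∈ _
    rw [hu]
    exact Subtype.property _
  have hself : (ComplexProj.chart i).symm w = ((chartAt (Fin (2 * d + 1) → ℂ) f).symm w).1 :=
    hsymm.self_of_nhds
  have hwf : (chartAt (Fin (2 * d + 1) → ℂ) f).symm w = f :=
    (chartAt (Fin (2 * d + 1) → ℂ) f).left_inv (mem_chart_source _ f)
  refine ⟨i, k, hrep w hself, ?_, ?_⟩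
  · have h1 := coe_iterationMap_of_eq_mk n (ComplexProj.insertNth_one_ne_zero i w) (hrep w hself)
      hself.symm
    have h2 : (iterationMap d n f).1 ∈ (ComplexProj.chart k).source := by
      rw [← hk]; exact mem_chart_source _ _
    rw [← hwf, h1] at h2
    exact (ComplexProj.rep_coord_ne_zero_iff k _ _).1 h2
  · filter_upwards [hsymm] with u hu
    have h1 := coe_iterationMap_of_eq_mk n (ComplexProj.insertNth_one_ne_zero i u) (hrep u hu)
      hu.symm
    simp only [Function.comp_apply]
    rw [hkval, h1]
    ext j
    exact ComplexProj.rep_div_coord k _ _ _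

theorem contMDiff_iterationMap (d n : ℕ) :
    ContMDiff 𝓘(ℂ, Fin (2 * d + 1) → ℂ) 𝓘(ℂ, Fin (2 * d ^ n + 1) → ℂ) ω (iterationMap d n) := by
  intro f
  obtain ⟨i, k, -, hk, hev⟩ := iterationMap_chart_eventuallyEq d n f
  refine contMDiffAt_iff.2 ⟨(continuous_iterationMap d n).continuousAt, ?_⟩
  have := ((contDiffAt_chartIter hk).congr_of_eventuallyEq hev).contDiffWithinAt (s := Set.univ)
  simpa using this

theorem injective_mfderiv_iterationMap {d n : ℕ} (hd : 2 ≤ d) (hn : 1 ≤ n) (f : RatSpace d) :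
    Function.Injective (mfderiv 𝓘(ℂ, Fin (2 * d + 1) → ℂ) 𝓘(ℂ, Fin (2 * d ^ n + 1) → ℂ)
      (iterationMap d n) f) := by
  obtain ⟨i, k, hw, hk, hev⟩ := iterationMap_chart_eventuallyEq d n f
  rw [((contMDiff_iterationMap d n f).mdifferentiableAt (by simp)).mfderiv_eq_fderiv_chart,
    hev.fderiv_eq]
  exact injective_fderiv_chartIter hd hn hw hk

end RatMap
end

/-- For `d ≥ 2` and `n ≥ 1`, the iteration map `φ_{d,n} : Rat_d → Rat_{dⁿ}` is nonsingular (its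
differential is injective on every tangent space); in particular it is a holomorphic immersion. -/
theorem proposition4p1 (d n : ℕ) (hd : 2 ≤ d) (hn : 1 ≤ n) :
    (∀ f : RatMap.RatSpace d,
      Function.Injective
        (mfderiv 𝓘(ℂ, Fin (2 * d + 1) → ℂ) 𝓘(ℂ, Fin (2 * d ^ n + 1) → ℂ)
          (RatMap.iterationMap d n) f)) ∧
    Manifold.IsImmersion 𝓘(ℂ, Fin (2 * d + 1) → ℂ) 𝓘(ℂ, Fin (2 * d ^ n + 1) → ℂ) ω
      (RatMap.iterationMap d n) := by
  have hinj := RatMap.injective_mfderiv_iterationMap hd hn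
  refine ⟨hinj, Fin (2 * d ^ n - 2 * d) → ℂ, inferInstance, inferInstance, fun f => ?_⟩
  refine (RatMap.contMDiff_iterationMap d n f).isImmersionAtOfComplement_of_injective_mfderiv
    (by simp) (by simp) ?_ (hinj f)
  have : d ≤ d ^ n := Nat.le_self_pow (by omega) d
  simp only [Module.finrank_fin_fun]
  omega
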